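/- Let $\mathcal A=(A_1,\dots,A_m)$ be a finite family of real $d\times d$ matrices. For a word $w=a_{i_1}\cdots a_{i_k}$ over the alphabet $\{a_1,\dots,a_m\}$ write $w(\mathcal A)=A_{i_1}\cdots A_{i_k}$ (the empty word gives the identity), let $M_k(\mathcal A)$ be the maximum of $\|w(\mathcal A)\|$ over all words $w$ of length $k$, and let $\rho(\mathcal A)=\lim_{k\to\infty}M_k(\mathcal A)^{1/k}$ be the joint spectral radius. If $\rho(\mathcal A)=1$, the family is called normalized; it is then called marginally unstable if the system $x(k+1)=A(k)x(k)$, $A(k)\in\mathcal A$, has an unbounded trajectory. A family is irreducible if its matrices have no common invariant subspace other than $\{0\}$ and the whole space. A nonempty word is simple if it is not a power of a shorter word. A simple word $\pi$ is dominant for a family if there is $q<1$ such that, after division of all the matrices by the joint spectral radius of the family, every product of them has spectral radius less than $q$, unless its word is a power of $\pi$ or of a cyclic permutation of $\pi$. The leading eigenvalues of a real matrix are its complex eigenvalues of maximal modulus; the leading eigenvalue is called unique and simple if it has algebraic multiplicity one and there is no other leading eigenvalue except its complex conjugate. Suppose that $\rho(\mathcal A)=1$ and that in some basis of $\mathbb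 R^d$ all the matrices of $\mathcal A$ have the form $$A_j=\begin{pmatrix}A_j^{(1)}&*\\0&A_j^{(2)}\end{pmatrix},\qquad j=1,\dots,m,$$ with nonempty square diagonal blocks of sizes independent of $j$, where the families $\mathcal A^{(i)}=(A_1^{(i)},\dots,A_m^{(i)})$, $i=1,2$, are irreducible. Suppose also that, for $i=1,2$, $\pi_i$ is a dominant word for $\mathcal A^{(i)}$ such that the leading eigenvalue of $\pi_i(\mathcal A^{(i)})$ is unique and simple. Then $\mathcal A$ is marginally unstable if and only if both of the following hold: (1) $\pi_1$ and $\pi_2$ coincide up to a cyclic permutation; (2) for $\pi=\pi_1$, the matrices $\pi(\mathcal A^{(1)})$ and $\pi(\mathcal A^{(2)})$ have the same leading eigenvalue (the same pair of conjugate eigenvalues if it is not real), and $\pi(\mathcal A)$ has a nontrivial Jordan block, i.e. one of size at least two, with this eigenvalue. If (1) and (2) hold, then $\mathcal A$ has linear growth: there are $c,C>0$ such that $c\,k\le M_k(\mathcal A)\le C\,k$ for all $k\ge1$. -/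

import Mathlib

/-- The product `A_{d₁} ⋯ A_{dₙ}` assigned to the word `a_{d₁} ⋯ a_{dₙ}`;
the empty word gives the identity matrix. -/
def wordProd {m : ℕ} {n : Type} [Fintype n] [DecidableEq n]
    (A : Fin m → Matrix n n ℝ) (w : List (Fin m)) : Matrix n n ℝ :=
  (w.map A).prod

section growth
open scoped Matrix.Norms.L2Operator

/-- `M_k(A)`: the maximal (Euclidean operator) norm of a product of `k` matrices of the family. -/
noncomputable def maxNorm {m : ℕ} {n : Type} [Fintype n] [DecidableEq n]
    (A : Fin m → Matrix n n ℝ) (k : ℕ) : ℝ :=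
  ⨆ w : Fin k → Fin m, ‖wordProd A (List.ofFn w)‖

/-- The joint spectral radius `lim_{k → ∞} M_k ^ (1 / k)`. The limit always exists,
see `tendsto_jointSpectralRadius`. -/
noncomputable def jointSpectralRadius {m : ℕ} {n : Type} [Fintype n] [DecidableEq n]
    (A : Fin m → Matrix n n ℝ) : ℝ :=
  Filter.limUnder Filter.atTop (fun k : ℕ => maxNorm A k ^ (1 / (k : ℝ)))

theorem maxNorm_nonneg {m : ℕ} {n : Type} [Fintype n] [DecidableEq n]
    (A : Fin m → Matrix n n ℝ) (k : ℕ) : 0 ≤ maxNorm A k :=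
  Real.iSup_nonneg fun _ => norm_nonneg _

theorem maxNorm_add_le {m : ℕ} {n : Type} [Fintype n] [DecidableEq n]
    (A : Fin m → Matrix n n ℝ) (j k : ℕ) :
    maxNorm A (j + k) ≤ maxNorm A j * maxNorm A k := by
  refine Real.iSup_le (fun w => ?_) (mul_nonneg (maxNorm_nonneg A j) (maxNorm_nonneg A k))
  have hw : List.ofFn w = List.ofFn (fun i : Fin j => w (Fin.castAdd k i)) ++
      List.ofFn (fun i : Fin k => w (Fin.natAdd j i)) := by
    rw [← List.ofFn_fin_append]
    congr 1
    exact (Fin.append_castAdd_natAdd (f := w)).symm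
  have hle : ∀ (l : ℕ) (v : Fin l → Fin m), ‖wordProd A (List.ofFn v)‖ ≤ maxNorm A l :=
    fun l v => le_ciSup (f := fun v : Fin l → Fin m => ‖wordProd A (List.ofFn v)‖)
      (Set.finite_range _).bddAbove v
  calc ‖wordProd A (List.ofFn w)‖
      ≤ ‖wordProd A (List.ofFn fun i : Fin j => w (Fin.castAdd k i))‖ *
        ‖wordProd A (List.ofFn fun i : Fin k => w (Fin.natAdd j i))‖ := by
        rw [hw, wordProd, List.map_append, List.prod_append]
        exact norm_mul_le _ _
    _ ≤ _ := mul_le_mul (hle _ _) (hle _ _) (norm_nonneg _) (maxNorm_nonneg A j)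

theorem tendsto_jointSpectralRadius {m : ℕ} {n : Type} [Fintype n] [DecidableEq n]
    (A : Fin m → Matrix n n ℝ) :
    Filter.Tendsto (fun k : ℕ => maxNorm A k ^ (1 / (k : ℝ))) Filter.atTop
      (nhds (jointSpectralRadius A)) := by
  apply tendsto_nhds_limUnder
  by_cases h0 : ∃ k, maxNorm A k = 0
  · obtain ⟨k, hk⟩ := h0
    refine ⟨0, tendsto_const_nhds.congr' ?_⟩
    filter_upwards [Filter.eventually_ge_atTop k, Filter.eventually_ge_atTop 1] with l hl h1
    have h := maxNorm_add_le A k (l - k)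
    rw [Nat.add_sub_cancel' hl, hk, zero_mul] at h
    rw [le_antisymm h (maxNorm_nonneg A l), Real.zero_rpow]
    have : (0 : ℝ) < l := by exact_mod_cast h1
    positivity
  · have hpos : ∀ k, 0 < maxNorm A k := fun k =>
      lt_of_le_of_ne (maxNorm_nonneg A k) fun h => h0 ⟨k, h.symm⟩
    have hsub : Subadditive fun k => Real.log (maxNorm A k) := fun j k => by
      rw [← Real.log_mul (hpos j).ne' (hpos k).ne']
      exact Real.log_le_log (hpos _) (maxNorm_add_le A j k)
    have hexp : ∀ k : ℕ, Real.exp (Real.log (maxNorm A k) / k) = maxNorm A k ^ (1 / (k : ℝ)) :=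
      fun k => by rw [Real.rpow_def_of_pos (hpos k), mul_one_div]
    by_cases hb : BddBelow (Set.range fun k : ℕ => Real.log (maxNorm A k) / k)
    · exact ⟨Real.exp hsub.lim, ((Real.continuous_exp.tendsto _).comp (hsub.tendsto_lim hb)).congr
        hexp⟩
    · have hbot : Filter.Tendsto (fun k : ℕ => Real.log (maxNorm A k) / k)
          Filter.atTop Filter.atBot := by
        refine Filter.tendsto_atBot.2 fun L => ?_
        have : ∃ k : ℕ, Real.log (maxNorm A k) / k < min L 0 := by
          by_contra! hc
          exact hb ⟨min L 0, by rintro _ ⟨k, rfl⟩; exact hc k⟩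
        obtain ⟨k, hk⟩ := this
        have hk0 : k ≠ 0 := by
          rintro rfl
          simp at hk
        filter_upwards [hsub.eventually_div_lt_of_div_lt hk0 hk] with p hp
        exact hp.le.trans (min_le_left _ _)
      exact ⟨0, (Real.tendsto_exp_atBot.comp hbot).congr hexp⟩

end growth

/-- The family shares a common invariant subspace other than `0` and the whole space. -/
def IsReducibleFamily {m : ℕ} {n : Type} [Fintype n] [DecidableEq n]
    (A : Fin m → Matrix n n ℝ) : Prop :=
  ∃ V : Submodule ℝ (n → ℝ), V ≠ ⊥ ∧ V ≠ ⊤ ∧ ∀ j, ∀ x ∈ V, Matrix.mulVec (A j) x ∈ V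

/-- A trajectory of `x(k+1) = A(k) x(k)` for some switching law with values in the family. -/
def IsTrajectory {m : ℕ} {n : Type} [Fintype n]
    (A : Fin m → Matrix n n ℝ) (x : ℕ → n → ℝ) : Prop :=
  ∃ σ : ℕ → Fin m, ∀ k, x (k + 1) = Matrix.mulVec (A (σ k)) (x k)

/-- The joint spectral radius is one and the system has an unbounded trajectory. -/
def IsMarginallyUnstable {m : ℕ} {n : Type} [Fintype n] [DecidableEq n]
    (A : Fin m → Matrix n n ℝ) : Prop :=
  jointSpectralRadius A = 1 ∧
    ¬ ∀ x : ℕ → n → ℝ, IsTrajectory A x → ∃ C : ℝ, ∀ k, ‖x k‖ ≤ C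

/-- The power `w ^ k` of a word; `w ^ 0` is the empty word. -/
def wordPow {m : ℕ} (w : List (Fin m)) (k : ℕ) : List (Fin m) :=
  (List.replicate k w).flatten

/-- A nonempty word that is not a power of a shorter word. -/
def IsSimpleWord {m : ℕ} (w : List (Fin m)) : Prop :=
  w ≠ [] ∧ ¬ ∃ v : List (Fin m), v.length < w.length ∧ ∃ k, w = wordPow v k

/-- A real matrix regarded as a complex one. -/
noncomputable def complexify {n : Type} (M : Matrix n n ℝ) : Matrix n n ℂ :=
  M.map (fun r : ℝ => (r : ℂ))

/-- The normalized family, in which each matrix is divided by the joint spectral radius. -/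
noncomputable def normalizedFamily {m : ℕ} {n : Type} [Fintype n] [DecidableEq n]
    (A : Fin m → Matrix n n ℝ) : Fin m → Matrix n n ℝ :=
  fun j => (jointSpectralRadius A)⁻¹ • A j

/-- A simple word `p` is dominant if, for some `q < 1`, each product of matrices of the
normalized family has spectral radius smaller than `q`, unless its word is a power of `p` or of
a cyclic permutation of `p`. -/
def IsDominantWord {m : ℕ} {n : Type} [Fintype n] [DecidableEq n]
    (A : Fin m → Matrix n n ℝ) (p : List (Fin m)) : Prop :=
  IsSimpleWord p ∧ ∃ q : ℝ, q < 1 ∧ ∀ w : List (Fin m),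
    (¬ ∃ v, p.IsRotated v ∧ ∃ k, w = wordPow v k) →
      spectralRadius ℂ (complexify (wordProd (normalizedFamily A) w)) < ENNReal.ofReal q

/-- A complex eigenvalue of largest modulus of a real matrix. -/
def IsLeadingEigenvalue {n : Type} [Fintype n] [DecidableEq n]
    (M : Matrix n n ℝ) (z : ℂ) : Prop :=
  z ∈ spectrum ℂ (complexify M) ∧ ∀ y ∈ spectrum ℂ (complexify M), ‖y‖ ≤ ‖z‖

/-- The leading eigenvalue is simple (of algebraic multiplicity one) and unique, where in the
non-real case uniqueness means that there are just two conjugate leading eigenvalues. -/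
def HasUniqueSimpleLeadingEigenvalue {n : Type} [Fintype n] [DecidableEq n]
    (M : Matrix n n ℝ) : Prop :=
  ∃ z : ℂ, IsLeadingEigenvalue M z ∧
    (∀ y : ℂ, IsLeadingEigenvalue M y → y = z ∨ y = (starRingEnd ℂ) z) ∧
    (complexify M).charpoly.rootMultiplicity z = 1

/-- `M` has a Jordan block of size at least two with eigenvalue `z`, i.e. a Jordan chain
`M u = z u`, `M v = z v + u` with `u ≠ 0`. -/
def HasNontrivialJordanBlock {n : Type} [Fintype n]
    (M : Matrix n n ℝ) (z : ℂ) : Prop :=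
  ∃ u v : n → ℂ, u ≠ 0 ∧ Matrix.mulVec (complexify M) u = z • u ∧
    Matrix.mulVec (complexify M) v = z • v + u

/-- The two conditions on a family `A` with diagonal blocks `A₁`, `A₂` and their dominant words
`p₁`, `p₂`: the words coincide up to a cyclic permutation, and for the common word the products of
the two blocks have equal leading eigenvalues, with which the product of `A` has a nontrivial
Jordan block. (For conjugate pairs, real matrices share both eigenvalues as soon as they share
one of them.) -/
def AreInJordanResonance {m : ℕ} {n n₁ n₂ : Type} [Fintype n] [DecidableEq n] [Fintype n₁]
    [DecidableEq n₁] [Fintype n₂] [DecidableEq n₂] (A : Fin m → Matrix n n ℝ)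
    (A₁ : Fin m → Matrix n₁ n₁ ℝ) (A₂ : Fin m → Matrix n₂ n₂ ℝ)
    (p₁ p₂ : List (Fin m)) : Prop :=
  p₁.IsRotated p₂ ∧
    ∃ z : ℂ, IsLeadingEigenvalue (wordProd A₁ p₁) z ∧ IsLeadingEigenvalue (wordProd A₂ p₁) z ∧
      HasNontrivialJordanBlock (wordProd A p₁) z

/-- `M_k ≍ k`. -/
def HasLinearGrowth {m : ℕ} {n : Type} [Fintype n] [DecidableEq n]
    (A : Fin m → Matrix n n ℝ) : Prop :=
  ∃ c C : ℝ, 0 < c ∧ 0 < C ∧ ∀ k : ℕ, 1 ≤ k → c * k ≤ maxNorm A k ∧ maxNorm A k ≤ C * k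

/-!
In a suitable basis each product of the family is block triangular, with diagonal blocks `A₁(w)` and
`A₂(w)` and an upper right block `Z(w)`, where `Z(uv) = A₁(u) Z(v) + Z(u) A₂(v)`. An irreducible
family of joint spectral radius at most one generates a bounded semigroup
(`exists_norm_wordProd_le`), so the diagonal blocks are bounded, `‖Z(w)‖` grows at most linearly in
the length of `w`, and everything depends on whether `Z` is bounded.

A dominant word forces contraction. If a long product in a bounded semigroup is not small, then two
of its prefix products almost coincide by compactness, and the segment between them almost has the
eigenvalue one (`exists_segment_of_le_norm`). If all products other than powers of `p` and of its
cyclic permutations have spectral radius less than `q < 1`, that segment is such a power. Hence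
`‖A₁(w)‖` decays exponentially in the number of disjoint factors of `w` that are not themselves
factors of a power of `p` (`IsDominantWord.isContracting`). The same argument shows that the product
of `p` has spectral radius at least one if the joint spectral radius is one
(`IsDominantWord.one_le_norm`); if the joint spectral radius is less than one, all nonempty words
contract.

Cut a word into minimal factors that contract for `A₁` or for `A₂`. Then `Z(w)` is the sum of
`A₁(prefix) Z(c) A₂(suffix)` over the factors `c`, and it is dominated by geometric series as soon
as `Z` is bounded on the words that contract for neither family (`exists_norm_upperBlock_le`). These
words are common factors of powers of `p₁` and `p₂`. If `p₁` and `p₂` are not cyclic permutations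
of each other, they have bounded length by a theorem of Fine-Wilf type
(`IsSimpleWord.isRotated_of_common_factor`). Otherwise `Z` is bounded on them if the product of `p₁`
is power bounded, and this fails only if there is a Jordan chain for an eigenvalue of modulus one.
As both diagonal blocks are power bounded, such an eigenvalue is a leading eigenvalue of both
(`exists_chain_of_not_isPowerBounded`), which is resonance.

Conversely, in resonance the common leading eigenvalue has modulus one, so the powers of the product
of `p₁` grow linearly (`exists_mul_le_norm_pow`). Periodic switching laws then have unbounded
trajectories, and submultiplicativity carries the lower bound over to all lengths.
-/

/-! ### Norms of products and the joint spectral radius -/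

section GrowthRate
open scoped Matrix.Norms.L2Operator

theorem wordProd_nil {m : ℕ} {n : Type} [Fintype n] [DecidableEq n]
    (A : Fin m → Matrix n n ℝ) : wordProd A [] = 1 := rfl

theorem wordProd_cons {m : ℕ} {n : Type} [Fintype n] [DecidableEq n]
    (A : Fin m → Matrix n n ℝ) (a : Fin m) (w : List (Fin m)) :
    wordProd A (a :: w) = A a * wordProd A w := by
  simp [wordProd]

theorem wordProd_append {m : ℕ} {n : Type} [Fintype n] [DecidableEq n]
    (A : Fin m → Matrix n n ℝ) (u w : List (Fin m)) :
    wordProd A (u ++ w) = wordProd A u * wordProd A w := by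
  simp [wordProd]

theorem wordProd_wordPow {m : ℕ} {n : Type} [Fintype n] [DecidableEq n]
    (A : Fin m → Matrix n n ℝ) (w : List (Fin m)) (k : ℕ) :
    wordProd A (wordPow w k) = wordProd A w ^ k := by
  simp [wordProd, wordPow, List.map_flatten, List.prod_flatten]

theorem exists_norm_map_le {E F : Type*} [NormedAddCommGroup E] [NormedSpace ℝ E]
    [FiniteDimensional ℝ E] [NormedAddCommGroup F] [NormedSpace ℝ F] (f : E →ₗ[ℝ] F) :
    ∃ C, 0 < C ∧ ∀ x, ‖f x‖ ≤ C * ‖x‖ := by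
  obtain ⟨C, hC, h⟩ := (LinearMap.toContinuousLinearMap f).bound
  exact ⟨C, hC, h⟩

theorem exists_norm_mulVec_le {n : Type} [Fintype n] [DecidableEq n] :
    ∃ C, 0 < C ∧ ∀ (M : Matrix n n ℝ) (x : n → ℝ), ‖M.mulVec x‖ ≤ C * ‖M‖ * ‖x‖ := by
  let f : Matrix n n ℝ →ₗ[ℝ] ((n → ℝ) →L[ℝ] (n → ℝ)) :=
    LinearMap.toContinuousLinearMap.toLinearMap ∘ₗ (Matrix.toLin' (R := ℝ)).toLinearMap
  obtain ⟨C, hC, h⟩ := exists_norm_map_le f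
  refine ⟨C, hC, fun M x => ?_⟩
  calc ‖M.mulVec x‖ = ‖f M x‖ := rfl
    _ ≤ ‖f M‖ * ‖x‖ := (f M).le_opNorm x
    _ ≤ _ := by gcongr; exact h M

theorem exists_norm_le_of_entries {ι : Type*} {n : Type} [Fintype n] [DecidableEq n]
    (X : ι → Matrix n n ℝ) (h : ∀ i j, ∃ C, ∀ k, |X k i j| ≤ C) : ∃ C, ∀ k, ‖X k‖ ≤ C := by
  choose C hC using h
  refine ⟨∑ i, ∑ j, C i j * ‖(Matrix.single i j 1 : Matrix n n ℝ)‖, fun k => ?_⟩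
  rw [Matrix.matrix_eq_sum_single (X k)]
  refine (norm_sum_le _ _).trans (Finset.sum_le_sum fun i _ => ?_)
  refine (norm_sum_le _ _).trans (Finset.sum_le_sum fun j _ => ?_)
  have : Matrix.single i j (X k i j) = X k i j • (Matrix.single i j 1 : Matrix n n ℝ) := by
    simp
  rw [this, norm_smul]
  gcongr
  exact hC i j k

theorem norm_wordProd_le_maxNorm {m : ℕ} {n : Type} [Fintype n] [DecidableEq n]
    (A : Fin m → Matrix n n ℝ) (w : List (Fin m)) : ‖wordProd A w‖ ≤ maxNorm A w.length := by
  have := le_ciSup (f := fun v : Fin w.length → Fin m => ‖wordProd A (List.ofFn v)‖)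
    (Set.finite_range _).bddAbove w.get
  simpa [maxNorm] using this

theorem maxNorm_le {m : ℕ} {n : Type} [Fintype n] [DecidableEq n]
    {A : Fin m → Matrix n n ℝ} {k : ℕ} {c : ℝ} (hc : 0 ≤ c)
    (h : ∀ w : List (Fin m), w.length = k → ‖wordProd A w‖ ≤ c) : maxNorm A k ≤ c :=
  Real.iSup_le (fun v => h _ (by simp)) hc

theorem jointSpectralRadius_nonneg {m : ℕ} {n : Type} [Fintype n] [DecidableEq n]
    (A : Fin m → Matrix n n ℝ) : 0 ≤ jointSpectralRadius A :=
  ge_of_tendsto' (tendsto_jointSpectralRadius A) fun k =>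
    Real.rpow_nonneg (maxNorm_nonneg A k) _

theorem exists_maxNorm_le_mul_pow {m : ℕ} {n : Type} [Fintype n] [DecidableEq n]
    {A : Fin m → Matrix n n ℝ} {r : ℝ} (hr : jointSpectralRadius A < r) :
    ∃ C, 0 < C ∧ ∀ k, maxNorm A k ≤ C * r ^ k := by
  have hr0 : 0 < r := (jointSpectralRadius_nonneg A).trans_lt hr
  obtain ⟨N, hN⟩ := Filter.eventually_atTop.1
    ((tendsto_jointSpectralRadius A).eventually_lt_const hr)
  have hsum : 0 ≤ ∑ k ∈ Finset.range (N + 1), maxNorm A k / r ^ k :=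
    Finset.sum_nonneg fun k _ => div_nonneg (maxNorm_nonneg A k) (by positivity)
  refine ⟨1 + ∑ k ∈ Finset.range (N + 1), maxNorm A k / r ^ k, by linarith, fun k => ?_⟩
  rcases le_or_gt k N with hk | hk
  · have h := Finset.single_le_sum (f := fun k => maxNorm A k / r ^ k)
      (fun k _ => div_nonneg (maxNorm_nonneg A k) (by positivity))
      (Finset.mem_range.2 (Nat.lt_succ_of_le hk))
    rw [← div_le_iff₀ (by positivity)]
    linarith
  · have hk0 : k ≠ 0 := by omega
    have h := (hN k hk.le).le
    have h2 : maxNorm A k ≤ r ^ k := by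
      have := pow_le_pow_left₀ (Real.rpow_nonneg (maxNorm_nonneg A k) _) h k
      rwa [one_div, Real.rpow_inv_natCast_pow (maxNorm_nonneg A k) hk0] at this
    have : 0 < r ^ k := by positivity
    nlinarith

theorem jointSpectralRadius_le_of_maxNorm_le {m : ℕ} {n : Type} [Fintype n] [DecidableEq n]
    {A : Fin m → Matrix n n ℝ} {C r : ℝ} (hC : 0 < C) (hr : 0 ≤ r)
    (h : ∀ k, maxNorm A k ≤ C * r ^ k) : jointSpectralRadius A ≤ r := by
  have h1 : Filter.Tendsto (fun k : ℕ => C ^ (1 / (k : ℝ)) * r) Filter.atTop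
      (nhds (C ^ (0 : ℝ) * r)) := by
    refine Filter.Tendsto.mul_const r ?_
    exact ((Real.continuousAt_const_rpow hC.ne').tendsto).comp
      tendsto_one_div_atTop_nhds_zero_nat
  rw [Real.rpow_zero, one_mul] at h1
  refine le_of_tendsto_of_tendsto (tendsto_jointSpectralRadius A) h1 ?_
  filter_upwards [Filter.eventually_ge_atTop 1] with k hk
  calc maxNorm A k ^ (1 / (k : ℝ)) ≤ (C * r ^ k) ^ (1 / (k : ℝ)) :=
        Real.rpow_le_rpow (maxNorm_nonneg A k) (h k) (by positivity)
    _ = C ^ (1 / (k : ℝ)) * r := by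
        rw [Real.mul_rpow hC.le (by positivity), one_div, Real.pow_rpow_inv_natCast hr (by omega)]

theorem jointSpectralRadius_lt_one {m : ℕ} {n : Type} [Fintype n] [DecidableEq n]
    {A : Fin m → Matrix n n ℝ} {N : ℕ} (hN : N ≠ 0) (h : maxNorm A N < 1) :
    jointSpectralRadius A < 1 := by
  have hb := maxNorm_nonneg A N
  have hpow : ∀ k : ℕ, maxNorm A ((k + 1) * N) ≤ maxNorm A N ^ (k + 1) := by
    intro k
    induction k with
    | zero => simp
    | succ k ih =>
      rw [add_mul (k + 1), one_mul, pow_succ]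
      exact (maxNorm_add_le A _ _).trans (mul_le_mul_of_nonneg_right ih hb)
  have hlim : Filter.Tendsto (fun k : ℕ => (k + 1) * N) Filter.atTop Filter.atTop :=
    Filter.tendsto_atTop_mono (fun k => (Nat.le_succ k).trans
      (Nat.le_mul_of_pos_right _ (Nat.pos_of_ne_zero hN))) Filter.tendsto_id
  have hle : jointSpectralRadius A ≤ maxNorm A N ^ (N : ℝ)⁻¹ := by
    refine le_of_tendsto' ((tendsto_jointSpectralRadius A).comp hlim) fun k => ?_
    have hk : ((k + 1 : ℕ) : ℝ) ≠ 0 := by positivity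
    calc maxNorm A ((k + 1) * N) ^ (1 / (((k + 1) * N : ℕ) : ℝ))
        ≤ (maxNorm A N ^ (k + 1)) ^ (1 / (((k + 1) * N : ℕ) : ℝ)) :=
          Real.rpow_le_rpow (maxNorm_nonneg A _) (hpow k) (by positivity)
      _ = maxNorm A N ^ (N : ℝ)⁻¹ := by
          rw [← Real.rpow_natCast, ← Real.rpow_mul hb]
          congr 1
          push_cast at hk ⊢
          field_simp
  exact hle.trans_lt (Real.rpow_lt_one hb h (by positivity))

/-- An irreducible family whose joint spectral radius is at most one generates a bounded
semigroup: the vectors with a bounded orbit form an invariant subspace, and if that subspace is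
zero, then by compactness of the sphere every vector can be doubled in a bounded number of steps,
so that the products grow exponentially. -/
theorem exists_norm_wordProd_le {m : ℕ} {n : Type} [Fintype n] [DecidableEq n]
    {A : Fin m → Matrix n n ℝ} (hirr : ¬ IsReducibleFamily A) (hA : jointSpectralRadius A ≤ 1) :
    ∃ C, 0 < C ∧ ∀ w, ‖wordProd A w‖ ≤ C := by
  suffices ∃ C, ∀ w, ‖wordProd A w‖ ≤ C by
    obtain ⟨C, hC⟩ := this
    exact ⟨max C 1, by positivity, fun w => (hC w).trans (le_max_left _ _)⟩
  let V : Submodule ℝ (n → ℝ) :=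
    { carrier := {x | ∃ C, ∀ w, ‖(wordProd A w).mulVec x‖ ≤ C}
      add_mem' := by
        rintro x y ⟨C, hC⟩ ⟨D, hD⟩
        refine ⟨C + D, fun w => ?_⟩
        rw [Matrix.mulVec_add]
        exact (norm_add_le _ _).trans (add_le_add (hC w) (hD w))
      zero_mem' := ⟨0, fun w => by simp⟩
      smul_mem' := by
        rintro c x ⟨C, hC⟩
        refine ⟨‖c‖ * C, fun w => ?_⟩
        rw [Matrix.mulVec_smul, norm_smul]
        exact mul_le_mul_of_nonneg_left (hC w) (norm_nonneg c) }
  have hV : ∀ x, x ∈ V ↔ ∃ C, ∀ w, ‖(wordProd A w).mulVec x‖ ≤ C := fun x => Iff.rfl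
  by_cases htop : V = ⊤
  · refine exists_norm_le_of_entries _ fun i j => ?_
    obtain ⟨C, hC⟩ := (hV (Pi.single j 1)).1 (htop ▸ Submodule.mem_top)
    refine ⟨C, fun w => ?_⟩
    have h := (norm_le_pi_norm _ i).trans (hC w)
    simpa using h
  exfalso
  have hbot : V = ⊥ := by
    by_contra hbot
    refine hirr ⟨V, hbot, htop, fun j x hx => ?_⟩
    obtain ⟨C, hC⟩ := hx
    refine ⟨C, fun w => ?_⟩
    have h := hC (w ++ [j])
    rwa [wordProd_append, wordProd_cons, wordProd_nil, mul_one, ← Matrix.mulVec_mulVec] at h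
  obtain ⟨x₀, -, hx₀V⟩ := SetLike.exists_of_lt (lt_top_iff_ne_top.2 htop)
  have hx₀ : x₀ ≠ 0 := fun h => hx₀V (h ▸ V.zero_mem)
  have hcover : Metric.sphere (0 : n → ℝ) 1 ⊆
      ⋃ w : List (Fin m), {x | 2 < ‖(wordProd A w).mulVec x‖} := by
    intro x hx
    have hx0 : x ≠ 0 := by
      rintro rfl
      simp at hx
    have : x ∉ V := by rwa [hbot, Submodule.mem_bot]
    rw [hV] at this
    push Not at this
    simpa using this 2
  obtain ⟨t, ht⟩ := (isCompact_sphere (0 : n → ℝ) 1).elim_finite_subcover _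
    (fun w => isOpen_lt continuous_const
      (continuous_const.matrix_mulVec continuous_id).norm) hcover
  obtain ⟨N, hN⟩ : ∃ N : ℕ, ∀ w ∈ t, w.length ≤ N :=
    ⟨t.sup List.length, fun w hw => Finset.le_sup (f := List.length) hw⟩
  have hdouble : ∀ x : n → ℝ, x ≠ 0 →
      ∃ w : List (Fin m), w.length ≤ N ∧ 2 * ‖x‖ ≤ ‖(wordProd A w).mulVec x‖ := by
    intro x hx
    have hx' : 0 < ‖x‖ := norm_pos_iff.2 hx
    have hmem : ‖x‖⁻¹ • x ∈ Metric.sphere (0 : n → ℝ) 1 := by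
      simp [norm_smul, hx'.ne']
    obtain ⟨w, hw, h⟩ := Set.mem_iUnion₂.1 (ht hmem)
    refine ⟨w, hN w hw, ?_⟩
    rw [Set.mem_ofPred_eq, Matrix.mulVec_smul, norm_smul, norm_inv, norm_norm,
      ← div_eq_inv_mul, lt_div_iff₀ hx'] at h
    exact h.le
  have hgrow : ∀ k : ℕ, ∃ w : List (Fin m), w.length ≤ k * N ∧
      2 ^ k * ‖x₀‖ ≤ ‖(wordProd A w).mulVec x₀‖ := by
    intro k
    induction k with
    | zero => exact ⟨[], by simp, by simp [wordProd_nil]⟩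
    | succ k ih =>
      obtain ⟨w, hw, h⟩ := ih
      have hne : (wordProd A w).mulVec x₀ ≠ 0 := by
        have := norm_pos_iff.2 hx₀
        exact norm_pos_iff.1 (lt_of_lt_of_le (by positivity) h)
      obtain ⟨v, hv, h'⟩ := hdouble _ hne
      refine ⟨v ++ w, by simp; linarith, ?_⟩
      rw [wordProd_append, ← Matrix.mulVec_mulVec, pow_succ']
      linarith
  set r : ℝ := (3 / 2) ^ (((N + 1 : ℕ) : ℝ)⁻¹) with hr
  have hr1 : 1 < r := Real.one_lt_rpow (by norm_num) (by positivity)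
  have hrN : r ^ (N + 1) = 3 / 2 := Real.rpow_inv_natCast_pow (by norm_num) (by simp)
  obtain ⟨C, hC, hmax⟩ := exists_maxNorm_le_mul_pow (hA.trans_lt hr1)
  obtain ⟨D, hD, hmul⟩ := exists_norm_mulVec_le (n := n)
  obtain ⟨k, hk⟩ := pow_unbounded_of_one_lt (D * C) (show (1 : ℝ) < 4 / 3 by norm_num)
  obtain ⟨w, hw, h⟩ := hgrow k
  have hx' : 0 < ‖x₀‖ := norm_pos_iff.2 hx₀
  have hlen : ‖wordProd A w‖ ≤ C * (3 / 2) ^ k := by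
    calc ‖wordProd A w‖ ≤ C * r ^ w.length := (norm_wordProd_le_maxNorm A w).trans (hmax _)
      _ ≤ C * r ^ ((N + 1) * k) := by
          gcongr
          · exact hr1.le
          · nlinarith
      _ = C * (3 / 2) ^ k := by rw [pow_mul, hrN]
  have h2 : 2 ^ k * ‖x₀‖ ≤ D * (C * (3 / 2) ^ k) * ‖x₀‖ :=
    h.trans ((hmul _ _).trans (by gcongr))
  have h3 := le_of_mul_le_mul_right h2 hx'
  have h4 : (2 : ℝ) ^ k = (4 / 3) ^ k * (3 / 2) ^ k := by
    rw [← mul_pow]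
    norm_num
  rw [h4, ← mul_assoc] at h3
  exact absurd (le_of_mul_le_mul_right h3 (by positivity)) (not_le.2 hk)

end GrowthRate

/-! ### Products of small spectral radius and contraction -/

section Contraction
open scoped Matrix.Norms.L2Operator

theorem exists_close_pair {X : Type*} [PseudoMetricSpace X] {s : Set X} (hs : TotallyBounded s)
    {ε : ℝ} (hε : 0 < ε) :
    ∃ K : ℕ, ∀ f : ℕ → X, (∀ i, f i ∈ s) → ∃ i j, i < j ∧ j ≤ K ∧ dist (f i) (f j) < ε := by
  obtain ⟨t, ht, hcov⟩ := Metric.totallyBounded_iff.1 hs (ε / 2) (half_pos hε)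
  have := ht.fintype
  refine ⟨Fintype.card t, fun f hf => ?_⟩
  have h : ∀ i, ∃ y : t, f i ∈ Metric.ball (y : X) (ε / 2) := fun i => by
    obtain ⟨y, hy, h⟩ := Set.mem_iUnion₂.1 (hcov (hf i))
    exact ⟨⟨y, hy⟩, h⟩
  choose g hg using h
  obtain ⟨i, j, hij, h⟩ := Fintype.exists_ne_map_eq_of_card_lt
    (fun i : Fin (Fintype.card t + 1) => g i) (by simp)
  have hdist : dist (f i) (f j) < ε := by
    have h1 := hg i
    have h2 := hg j
    rw [← h] at h2
    have := dist_triangle_right (f i) (f j) (g i)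
    rw [Metric.mem_ball] at h1 h2
    linarith
  rcases lt_or_gt_of_ne hij with hlt | hlt
  · exact ⟨i, j, hlt, by omega, hdist⟩
  · exact ⟨j, i, hlt, by omega, by rwa [dist_comm]⟩

theorem complexify_mul {n : Type} [Fintype n] (M N : Matrix n n ℝ) :
    complexify (M * N) = complexify M * complexify N :=
  Matrix.map_mul (f := Complex.ofRealHom)

theorem complexify_pow {n : Type} [Fintype n] [DecidableEq n] (M : Matrix n n ℝ) (k : ℕ) :
    complexify (M ^ k) = complexify M ^ k :=
  map_pow Complex.ofRealHom.mapMatrix M k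

theorem pow_card_le_norm_prod_map {c : ℝ} (hc : 0 ≤ c) (s : Multiset ℂ) (f : ℂ → ℂ)
    (h : ∀ x ∈ s, c ≤ ‖f x‖) : c ^ s.card ≤ ‖(s.map f).prod‖ := by
  induction s using Multiset.induction with
  | empty => simp
  | cons a s ih =>
    rw [Multiset.card_cons, Multiset.map_cons, Multiset.prod_cons, norm_mul, pow_succ']
    exact mul_le_mul (h a (Multiset.mem_cons_self a s))
      (ih fun x hx => h x (Multiset.mem_cons_of_mem hx)) (pow_nonneg hc _) (norm_nonneg _)

theorem norm_le_of_spectralRadius_lt {n : Type} [Fintype n] [DecidableEq n] {Q : Matrix n n ℂ}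
    {q : ℝ} (h : spectralRadius ℂ Q < ENNReal.ofReal q) {z : ℂ} (hz : z ∈ spectrum ℂ Q) :
    ‖z‖ ≤ q := by
  have h1 : (‖z‖₊ : ENNReal) ≤ spectralRadius ℂ Q := le_iSup₂ (α := ENNReal) z hz
  have h2 := h1.trans_lt h
  rw [← ENNReal.ofReal_coe_nnreal, coe_nnnorm] at h2
  exact (ENNReal.ofReal_lt_ofReal_iff'.1 h2).1.le

/-- `det (Q - 1)` is, up to sign, the product of the numbers `1 - z` over the eigenvalues `z`. -/
theorem pow_card_le_abs_det_sub_one {n : Type} [Fintype n] [DecidableEq n] {Q : Matrix n n ℝ}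
    {q : ℝ} (hq : q ≤ 1) (h : spectralRadius ℂ (complexify Q) < ENNReal.ofReal q) :
    (1 - q) ^ Fintype.card n ≤ |(Q - 1).det| := by
  have hs : (complexify Q).charpoly.Splits := IsAlgClosed.splits _
  have hdet : ((1 - Q).det : ℂ) =
      ((complexify Q).charpoly.roots.map fun x => 1 - x).prod := by
    rw [← hs.eval_eq_prod_roots_of_monic (Matrix.charpoly_monic _), Matrix.eval_charpoly,
      ← Complex.ofRealHom_eq_coe, RingHom.map_det, map_sub, map_one, map_one]
    rfl
  have hcard : (complexify Q).charpoly.roots.card = Fintype.card n := by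
    rw [← hs.natDegree_eq_card_roots, Matrix.charpoly_natDegree_eq_dim]
  have habs : |(Q - 1).det| = ‖((1 - Q).det : ℂ)‖ := by
    rw [Complex.norm_real, Real.norm_eq_abs, ← neg_sub, Matrix.det_neg, abs_mul, abs_pow]
    simp
  rw [habs, hdet, ← hcard]
  refine pow_card_le_norm_prod_map (by linarith) _ _ fun x hx => ?_
  have hx' := norm_le_of_spectralRadius_lt h
    (Matrix.mem_spectrum_of_isRoot_charpoly (Polynomial.isRoot_of_mem_roots hx))
  have := norm_sub_norm_le (1 : ℂ) x
  rw [norm_one] at this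
  linarith

/-- In a bounded semigroup, a product of many factors whose norm is not small has a segment of
consecutive factors whose spectral radius is not much smaller than one. By compactness two of the
prefix products almost agree; the segment `Q` between them then almost fixes a row vector of
norm not too small, whereas `|det (Q - 1)|` is bounded below if `Q` has small spectral radius. -/
theorem exists_segment_of_le_norm {m : ℕ} {n : Type} [Fintype n] [DecidableEq n]
    {A : Fin m → Matrix n n ℝ} {C : ℝ} (hC0 : 0 < C) (hC : ∀ w, ‖wordProd A w‖ ≤ C)
    {q δ : ℝ} (hq : q < 1) (hδ : 0 < δ) :
    ∃ K : ℕ, ∀ us : List (List (Fin m)), us.length = K + 1 → δ ≤ ‖wordProd A us.flatten‖ →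
      ∃ i j, i < j ∧ j ≤ us.length ∧
        ¬ spectralRadius ℂ (complexify (wordProd A ((us.drop i).take (j - i)).flatten)) <
          ENNReal.ofReal q := by
  obtain ⟨D, hD⟩ := (isCompact_closedBall (0 : Matrix n n ℝ) C).exists_bound_of_continuousOn
    (f := fun Q => (Q - 1).adjugate)
    (Continuous.matrix_adjugate (continuous_id.sub continuous_const)).continuousOn
  set D' := max D 1
  have hD' : 0 < D' := by positivity
  set ε := (1 - q) ^ Fintype.card n * δ / (D' * C) with hε
  have hq' : 0 < 1 - q := by linarith
  have hε0 : 0 < ε := by positivity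
  obtain ⟨K, hK⟩ := exists_close_pair
    (isCompact_closedBall (0 : Matrix n n ℝ) C).totallyBounded hε0
  refine ⟨K, fun us hlen hus => ?_⟩
  obtain ⟨i, j, hij, hjK, hdist⟩ := hK (fun i => wordProd A (us.take i).flatten)
    (fun i => by simpa using hC _)
  refine ⟨i, j, hij, by omega, fun hrad => ?_⟩
  set Q := wordProd A ((us.drop i).take (j - i)).flatten with hQ
  set P := wordProd A (us.take i).flatten with hP
  have hj : wordProd A (us.take j).flatten = P * Q := by
    rw [hP, hQ, ← wordProd_append, ← List.flatten_append, ← List.take_add,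
      Nat.add_sub_cancel' hij.le]
  have hPδ : δ ≤ ‖P‖ * C := by
    refine hus.trans ?_
    rw [← List.take_append_drop i us, List.flatten_append, wordProd_append]
    exact (norm_mul_le _ _).trans (mul_le_mul_of_nonneg_left (hC _) (norm_nonneg _))
  have hdet : (Q - 1).det • P = (P * Q - P) * (Q - 1).adjugate := by
    have : P * Q - P = P * (Q - 1) := by noncomm_ring
    rw [this, mul_assoc, Matrix.mul_adjugate, Matrix.mul_smul, mul_one]
  have hlow := pow_card_le_abs_det_sub_one hq.le hrad
  have hdist' : ‖P * Q - P‖ < ε := by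
    rw [← dist_eq_norm, dist_comm, ← hj]
    exact hdist
  have h2 : |(Q - 1).det| * ‖P‖ < ε * D' := by
    rw [← Real.norm_eq_abs, ← norm_smul, hdet]
    calc ‖(P * Q - P) * (Q - 1).adjugate‖ ≤ ‖P * Q - P‖ * ‖(Q - 1).adjugate‖ := norm_mul_le _ _
      _ ≤ ‖P * Q - P‖ * D' := by
          gcongr
          exact (hD Q (by simpa using hC _)).trans (le_max_left _ _)
      _ < ε * D' := by gcongr
  have h3 : (1 - q) ^ Fintype.card n * δ ≤ |(Q - 1).det| * ‖P‖ * C := by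
    rw [mul_assoc]
    exact mul_le_mul hlow hPδ hδ.le (abs_nonneg _)
  have h4 : ε * D' * C = (1 - q) ^ Fintype.card n * δ := by
    rw [hε]
    field_simp
  have h5 := mul_lt_mul_of_pos_right h2 hC0
  linarith

/-- `u` is a factor of a power of `p` or of a cyclic permutation of `p`. -/
def IsFactorOfPower {m : ℕ} (p u : List (Fin m)) : Prop :=
  ∃ v, p.IsRotated v ∧ ∃ k, u <:+: wordPow v k

open Classical in
/-- The set `S` of words is contracting for the family: in a product of words, every factor from
`S` contributes a definite decay of the norm. -/
def IsContracting {m : ℕ} {n : Type} [Fintype n] [DecidableEq n]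
    (A : Fin m → Matrix n n ℝ) (S : Set (List (Fin m))) : Prop :=
  ∃ C θ : ℝ, 0 < C ∧ 0 < θ ∧ θ < 1 ∧ ∀ cs : List (List (Fin m)),
    ‖wordProd A cs.flatten‖ ≤ C * θ ^ cs.countP (· ∈ S)

open Classical in
/-- The factors outside `S` can be merged into the factors from `S` that follow them. -/
theorem exists_flatten_eq_append {α : Type*} {S : Set (List α)}
    (hS : ∀ x u, u ∈ S → x ++ u ∈ S) (cs : List (List α)) :
    ∃ (us : List (List α)) (x : List α), (∀ u ∈ us, u ∈ S) ∧ us.length = cs.countP (· ∈ S) ∧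
      cs.flatten = us.flatten ++ x := by
  induction cs with
  | nil => exact ⟨[], [], by simp⟩
  | cons c cs ih =>
    obtain ⟨us, x, hus, hlen, h⟩ := ih
    by_cases hc : c ∈ S
    · refine ⟨c :: us, x, ?_, by simp [hc, hlen], by simp [h]⟩
      simpa [hc] using hus
    · cases us with
      | nil => exact ⟨[], c ++ x, by simp, by simpa [hc] using hlen, by simp [h]⟩
      | cons u us =>
        refine ⟨(c ++ u) :: us, x, ?_, by simpa [hc] using hlen, by simp [h]⟩
        simp only [List.mem_cons, forall_eq_or_imp] at hus ⊢
        exact ⟨hS c u hus.1, hus.2⟩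

theorem isContracting_of_norm_le_half {m : ℕ} {n : Type} [Fintype n] [DecidableEq n]
    {A : Fin m → Matrix n n ℝ} {C : ℝ} (hC0 : 0 < C) (hC : ∀ w, ‖wordProd A w‖ ≤ C)
    {S : Set (List (Fin m))} (hS : ∀ x u, u ∈ S → x ++ u ∈ S) {K : ℕ}
    (hK : ∀ us : List (List (Fin m)), us.length = K + 1 → (∀ u ∈ us, u ∈ S) →
      ‖wordProd A us.flatten‖ ≤ 1 / 2) : IsContracting A S := by
  classical
  set θ : ℝ := (1 / 2) ^ (((K + 1 : ℕ) : ℝ)⁻¹) with hθ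
  have hθ0 : 0 < θ := by positivity
  have hθ1 : θ < 1 := Real.rpow_lt_one (by norm_num) (by norm_num) (by positivity)
  have hθK : θ ^ (K + 1) = 1 / 2 := Real.rpow_inv_natCast_pow (by norm_num) (by simp)
  have key : ∀ (l : ℕ) (us : List (List (Fin m))) (x : List (Fin m)), us.length = l →
      (∀ u ∈ us, u ∈ S) → ‖wordProd A (us.flatten ++ x)‖ ≤ 2 * C * θ ^ l := by
    intro l
    induction l using Nat.strong_induction_on with
    | _ l ih =>
      intro us x hlen hus
      rcases lt_or_ge l (K + 1) with hl | hl
      · have h1 : θ ^ (K + 1) ≤ θ ^ l := pow_le_pow_of_le_one hθ0.le hθ1.le hl.le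
        refine (hC _).trans ?_
        nlinarith
      · have h1 := ih (l - (K + 1)) (by omega) (us.drop (K + 1)) x (by simp [hlen])
          (fun u hu => hus u (List.mem_of_mem_drop hu))
        have h2 := hK (us.take (K + 1)) (by simp; omega)
          (fun u hu => hus u (List.mem_of_mem_take hu))
        have hsplit : us.flatten ++ x =
            (us.take (K + 1)).flatten ++ ((us.drop (K + 1)).flatten ++ x) := by
          rw [← List.append_assoc, ← List.flatten_append, List.take_append_drop]
        rw [hsplit, wordProd_append]
        calc _ ≤ 1 / 2 * (2 * C * θ ^ (l - (K + 1))) :=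
              (norm_mul_le _ _).trans (mul_le_mul h2 h1 (norm_nonneg _) (by norm_num))
          _ = 2 * C * (θ ^ (K + 1) * θ ^ (l - (K + 1))) := by rw [hθK]; ring
          _ = 2 * C * θ ^ l := by rw [← pow_add, Nat.add_sub_cancel' hl]
  refine ⟨2 * C, θ, by positivity, hθ0, hθ1, fun cs => ?_⟩
  obtain ⟨us, x, hus, hlen, h⟩ := exists_flatten_eq_append hS cs
  rw [h]
  exact key _ us x hlen hus

theorem normalizedFamily_eq {m : ℕ} {n : Type} [Fintype n] [DecidableEq n]
    {A : Fin m → Matrix n n ℝ} (hA : jointSpectralRadius A = 1) : normalizedFamily A = A := by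
  funext j
  simp [normalizedFamily, hA]

/-- For an irreducible family of joint spectral radius one with dominant word `p`, the words that
are not factors of powers of `p` contract. -/
theorem IsDominantWord.isContracting {m : ℕ} {n : Type} [Fintype n] [DecidableEq n]
    {A : Fin m → Matrix n n ℝ} {p : List (Fin m)} (hp : IsDominantWord A p)
    (hirr : ¬ IsReducibleFamily A) (hA : jointSpectralRadius A = 1) :
    IsContracting A {u | ¬ IsFactorOfPower p u} := by
  obtain ⟨-, q, hq, hdom⟩ := hp
  rw [normalizedFamily_eq hA] at hdom
  obtain ⟨C, hC0, hC⟩ := exists_norm_wordProd_le hirr hA.le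
  obtain ⟨K, hK⟩ := exists_segment_of_le_norm hC0 hC hq (show (0 : ℝ) < 1 / 2 by norm_num)
  refine isContracting_of_norm_le_half hC0 hC ?_ (K := K) fun us hlen hus => ?_
  · rintro x u hu ⟨v, hv, k, h⟩
    exact hu ⟨v, hv, k, (List.suffix_append x u).isInfix.trans h⟩
  · by_contra! hlt
    obtain ⟨i, j, hij, hj, hrad⟩ := hK us hlen hlt.le
    have hpow := not_imp_comm.1 (hdom _) hrad
    obtain ⟨v, hv, k, hw⟩ := hpow
    have hi : i < us.length := by omega
    -- The first factor of the segment would be a factor of a power of `p`.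
    refine hus us[i] (List.getElem_mem hi) ⟨v, hv, k, ?_⟩
    rw [← hw]
    obtain ⟨s, hs⟩ : ∃ s, j - i = s + 1 := ⟨j - i - 1, by omega⟩
    rw [hs, List.drop_eq_getElem_cons hi, List.take_succ_cons, List.flatten_cons]
    exact (List.prefix_append _ _).isInfix

theorem isContracting_of_jointSpectralRadius_lt_one {m : ℕ} {n : Type} [Fintype n]
    [DecidableEq n] {A : Fin m → Matrix n n ℝ} (hA : jointSpectralRadius A < 1) :
    IsContracting A {u | u ≠ []} := by
  classical
  obtain ⟨θ, hθ, hθ1⟩ := exists_between hA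
  have hθ0 := (jointSpectralRadius_nonneg A).trans_lt hθ
  obtain ⟨C, hC0, hC⟩ := exists_maxNorm_le_mul_pow hθ
  refine ⟨C, θ, hC0, hθ0, hθ1, fun cs => ?_⟩
  have hlen : cs.countP (· ∈ {u : List (Fin m) | u ≠ []}) ≤ cs.flatten.length := by
    induction cs with
    | nil => simp
    | cons c cs ih =>
      cases c with
      | nil => simpa using ih
      | cons a c =>
        simp at ih ⊢
        omega
  refine ((norm_wordProd_le_maxNorm A _).trans (hC _)).trans ?_
  gcongr C * ?_
  refine pow_le_pow_of_le_one hθ0.le hθ1.le ?_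
  convert hlen

theorem charpoly_complexify_wordProd_of_isRotated {m : ℕ} {n : Type} [Fintype n] [DecidableEq n]
    (A : Fin m → Matrix n n ℝ) {p v : List (Fin m)} (h : p.IsRotated v) :
    (complexify (wordProd A p)).charpoly = (complexify (wordProd A v)).charpoly := by
  obtain ⟨k, hk, rfl⟩ := List.isRotated_iff_mod.1 h
  rw [List.rotate_eq_drop_append_take hk, wordProd_append, complexify_mul,
    Matrix.charpoly_mul_comm, ← complexify_mul, ← wordProd_append, List.take_append_drop]

theorem spectrum_complexify_wordProd_of_isRotated {m : ℕ} {n : Type} [Fintype n] [DecidableEq n]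
    (A : Fin m → Matrix n n ℝ) {p v : List (Fin m)} (h : p.IsRotated v) :
    spectrum ℂ (complexify (wordProd A p)) = spectrum ℂ (complexify (wordProd A v)) := by
  ext z
  rw [Matrix.mem_spectrum_iff_isRoot_charpoly, Matrix.mem_spectrum_iff_isRoot_charpoly,
    charpoly_complexify_wordProd_of_isRotated A h]

/-- The product of a dominant word of an irreducible family of joint spectral radius one has
spectral radius at least one. Otherwise the spectral radii of all nonempty products would be
bounded by some `q < 1`, and long products would be small (a weak form of the theorem of Berger
and Wang). -/
theorem IsDominantWord.one_le_norm {m : ℕ} {n : Type} [Fintype n] [DecidableEq n]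
    {A : Fin m → Matrix n n ℝ} {p : List (Fin m)} (hp : IsDominantWord A p)
    (hirr : ¬ IsReducibleFamily A) (hA : jointSpectralRadius A = 1) {z : ℂ}
    (hz : IsLeadingEigenvalue (wordProd A p) z) : 1 ≤ ‖z‖ := by
  by_contra! hz1
  obtain ⟨-, q, hq, hdom⟩ := hp
  rw [normalizedFamily_eq hA] at hdom
  obtain ⟨C, hC0, hC⟩ := exists_norm_wordProd_le hirr hA.le
  set q' := max q ((1 + ‖z‖) / 2) with hq'
  have hq'1 : q' < 1 := max_lt hq (by linarith)
  have hzq : ‖z‖ < q' := lt_max_of_lt_right (by linarith)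
  have hsmall : ∀ w : List (Fin m), w ≠ [] →
      spectralRadius ℂ (complexify (wordProd A w)) < ENNReal.ofReal q' := by
    intro w hw
    by_cases hpow : ∃ v, p.IsRotated v ∧ ∃ k, w = wordPow v k
    · obtain ⟨v, hv, k, rfl⟩ := hpow
      have hk : k ≠ 0 := by
        rintro rfl
        simp [wordPow] at hw
      have hle : spectralRadius ℂ (complexify (wordProd A (wordPow v k))) ≤
          ENNReal.ofReal ‖z‖ := by
        refine iSup₂_le fun y hy => ?_
        rw [wordProd_wordPow, complexify_pow,
          spectrum.map_pow_of_pos _ (Nat.pos_of_ne_zero hk)] at hy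
        obtain ⟨x, hx, rfl⟩ := hy
        rw [← spectrum_complexify_wordProd_of_isRotated A hv] at hx
        have hxz := hz.2 x hx
        rw [← ENNReal.ofReal_coe_nnreal, coe_nnnorm]
        refine ENNReal.ofReal_le_ofReal ?_
        simp only [norm_pow]
        exact (pow_le_of_le_one (norm_nonneg _) (hxz.trans hz1.le) hk).trans hxz
      exact hle.trans_lt ((ENNReal.ofReal_lt_ofReal_iff ((norm_nonneg z).trans_lt hzq)).2 hzq)
    · exact (hdom w hpow).trans_le (ENNReal.ofReal_le_ofReal (le_max_left _ _))
  obtain ⟨K, hK⟩ := exists_segment_of_le_norm hC0 hC hq'1 (show (0 : ℝ) < 1 / 2 by norm_num)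
  have hhalf : maxNorm A (K + 1) ≤ 1 / 2 := by
    refine maxNorm_le (by norm_num) fun w hw => ?_
    by_contra! hlt
    have hflat : ∀ w : List (Fin m), (w.map fun a => [a]).flatten = w := fun w => by
      induction w with
      | nil => rfl
      | cons a w ih => simpa using ih
    obtain ⟨i, j, hij, hj, hrad⟩ := hK (w.map fun a => [a]) (by simpa using hw)
      (by rw [hflat]; exact hlt.le)
    refine hrad (hsmall _ fun hnil => ?_)
    have hi : i < (w.map fun a => [a]).length := by omega
    obtain ⟨s, hs⟩ : ∃ s, j - i = s + 1 := ⟨j - i - 1, by omega⟩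
    rw [hs, List.drop_eq_getElem_cons hi, List.take_succ_cons, List.flatten_cons] at hnil
    simp at hnil
  have := jointSpectralRadius_lt_one (Nat.succ_ne_zero K) (by linarith)
  linarith

end Contraction

/-! ### Periodicity of words -/

section Words

theorem wordPow_zero {m : ℕ} (v : List (Fin m)) : wordPow v 0 = [] := rfl

theorem wordPow_succ {m : ℕ} (v : List (Fin m)) (k : ℕ) :
    wordPow v (k + 1) = v ++ wordPow v k := by
  simp [wordPow, List.replicate_succ]

theorem wordPow_succ' {m : ℕ} (v : List (Fin m)) (k : ℕ) :
    wordPow v (k + 1) = wordPow v k ++ v := by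
  simp [wordPow, List.replicate_succ']

theorem length_wordPow {m : ℕ} (v : List (Fin m)) (k : ℕ) :
    (wordPow v k).length = k * v.length := by
  simp [wordPow]

theorem getElem?_wordPow {m : ℕ} (v : List (Fin m)) (k i : ℕ) (hi : i < k * v.length) :
    (wordPow v k)[i]? = v[i % v.length]? := by
  induction k generalizing i with
  | zero => simp at hi
  | succ k ih =>
    rw [wordPow_succ]
    rcases lt_or_ge i v.length with h | h
    · rw [List.getElem?_append_left h, Nat.mod_eq_of_lt h]
    · rw [List.getElem?_append_right h, ih _ (by rw [add_mul, one_mul] at hi; omega),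
        Nat.mod_eq_sub_mod h]

theorem IsFactorOfPower.exists_getElem? {m : ℕ} {p u : List (Fin m)} (hp : p ≠ [])
    (h : IsFactorOfPower p u) :
    ∃ c, ∀ i < u.length, u[i]? = p[(c + i) % p.length]? := by
  obtain ⟨v, ⟨r, rfl⟩, k, s, t, h⟩ := h
  have hlen : 0 < p.length := List.length_pos_of_ne_nil hp
  refine ⟨s.length + r, fun i hi => ?_⟩
  have h1 : (wordPow (p.rotate r) k)[s.length + i]? = u[i]? := by
    rw [← h, List.append_assoc, List.getElem?_append_right (by omega),
      Nat.add_sub_cancel_left, List.getElem?_append_left hi]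
  have h2 : s.length + i < k * (p.rotate r).length := by
    rw [← length_wordPow, ← h]
    simp
    omega
  rw [← h1, getElem?_wordPow _ _ _ h2, List.length_rotate,
    List.getElem?_rotate (Nat.mod_lt _ hlen), Nat.mod_add_mod]
  congr 2
  ring

theorem IsSimpleWord.eq_of_periodic {m : ℕ} {p : List (Fin m)} (hp : IsSimpleWord p) {c g : ℕ}
    (hg : g ∣ p.length)
    (h : Function.Periodic (fun i => p[(c + i) % p.length]?) g) : g = p.length := by
  have hlen : 0 < p.length := List.length_pos_of_ne_nil hp.1
  have h0 : Function.Periodic (fun i => p[i % p.length]?) g := by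
    intro i
    have hshift : ∀ i, (c + (i + c * (p.length - 1))) % p.length = i % p.length := by
      intro i
      have : c + (i + c * (p.length - 1)) = i + p.length * c := by
        obtain ⟨l, hl⟩ : ∃ l, p.length = l + 1 := ⟨p.length - 1, by omega⟩
        rw [hl, Nat.add_sub_cancel]
        ring
      rw [this, Nat.add_mul_mod_self_left]
    have := h (i + c * (p.length - 1))
    simp only at this ⊢
    rw [add_right_comm i, hshift, hshift] at this
    exact this
  by_contra hne
  have hlt : g < p.length := lt_of_le_of_ne (Nat.le_of_dvd hlen hg) hne
  have hg0 : 0 < g := Nat.pos_of_dvd_of_pos hg hlen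
  have htake : (p.take g).length = g := by simp [hlt.le]
  have hdiv : p.length / g * g = p.length := Nat.div_mul_cancel hg
  refine hp.2 ⟨p.take g, by rw [htake]; exact hlt, p.length / g, ?_⟩
  refine List.ext_getElem? fun i => ?_
  rcases lt_or_ge i p.length with hi | hi
  · have hig := Nat.mod_lt i hg0
    rw [getElem?_wordPow _ _ _ (by rw [htake, hdiv]; exact hi), htake,
      List.getElem?_take_of_lt hig]
    have h1 := (h0.nat_mul (i / g)) (i % g)
    simp only [Nat.cast_id] at h1
    rw [Nat.mod_add_div', Nat.mod_eq_of_lt hi, Nat.mod_eq_of_lt (by omega)] at h1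
    exact h1
  · rw [List.getElem?_eq_none hi, List.getElem?_eq_none]
    rw [length_wordPow, htake, hdiv]
    exact hi

theorem Function.Periodic.nat_gcd {α : Type*} {f : ℕ → α} {a b : ℕ} (hb : 0 < b)
    (ha : Function.Periodic f a) (hb' : Function.Periodic f b) :
    Function.Periodic f (a.gcd b) := by
  rcases (Nat.gcd_le_right a hb).lt_or_eq with h | h
  · obtain ⟨k, -, hk⟩ := Nat.exists_mul_mod_eq_gcd h
    intro i
    have h1 := (hb'.nat_mul (a * k / b)) (i + a.gcd b)
    have h2 := (ha.nat_mul k) i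
    simp only [Nat.cast_id] at h1 h2
    rw [← h1, ← h2]
    congr 1
    have := Nat.mod_add_div' (a * k) b
    rw [hk] at this
    rw [add_assoc, this, mul_comm a k]
  · rwa [h]

/-- Two simple words that are not cyclic permutations of each other have no long common factor of
their powers: such a factor has both lengths as periods, hence also their greatest common
divisor. -/
theorem IsSimpleWord.isRotated_of_common_factor {m : ℕ} {p p' u : List (Fin m)}
    (hp : IsSimpleWord p) (hp' : IsSimpleWord p') (h : IsFactorOfPower p u)
    (h' : IsFactorOfPower p' u) (hu : p.length * p'.length ≤ u.length) : p.IsRotated p' := by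
  have hl : 0 < p.length := List.length_pos_of_ne_nil hp.1
  have hl' : 0 < p'.length := List.length_pos_of_ne_nil hp'.1
  obtain ⟨c, hc⟩ := h.exists_getElem? hp.1
  obtain ⟨c', hc'⟩ := h'.exists_getElem? hp'.1
  have heq : ∀ i, p[(c + i) % p.length]? = p'[(c' + i) % p'.length]? := by
    intro i
    have hi : i % (p.length * p'.length) < u.length :=
      (Nat.mod_lt _ (by positivity)).trans_le hu
    have h1 := (hc _ hi).symm.trans (hc' _ hi)
    rwa [← Nat.add_mod_mod, Nat.mod_mul_right_mod, Nat.add_mod_mod, ← Nat.add_mod_mod c',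
      Nat.mod_mul_left_mod, Nat.add_mod_mod] at h1
  have hper : Function.Periodic (fun i => p[(c + i) % p.length]?) p.length := fun i => by
    simp [← add_assoc]
  have hper' : Function.Periodic (fun i => p[(c + i) % p.length]?) p'.length := fun i => by
    simp only [heq]
    simp [← add_assoc]
  have hgcd := hper.nat_gcd hl' hper'
  have hg := hp.eq_of_periodic (Nat.gcd_dvd_left _ _) hgcd
  have hg' : p.length.gcd p'.length = p'.length := by
    refine hp'.eq_of_periodic (c := c') (Nat.gcd_dvd_right _ _) ?_
    simpa only [heq] using hgcd
  have hlen : p.length = p'.length := hg.symm.trans hg'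
  have hrot : p.rotate c = p'.rotate c' := by
    refine List.ext_getElem? fun i => ?_
    rcases lt_or_ge i p.length with hi | hi
    · rw [List.getElem?_rotate hi, List.getElem?_rotate (hlen ▸ hi), add_comm, heq,
        add_comm c']
    · rw [List.getElem?_eq_none (by simpa using hi),
        List.getElem?_eq_none (by simpa [← hlen] using hi)]
  exact (List.IsRotated.trans ⟨c, hrot⟩ (List.IsRotated.symm ⟨c', rfl⟩))

theorem exists_eq_append_of_suffix_wordPow {m : ℕ} {v : List (Fin m)} {k : ℕ} :
    ∀ {u : List (Fin m)}, u <:+ wordPow v k →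
      ∃ s j, u = s ++ wordPow v j ∧ s.length ≤ v.length := by
  induction k with
  | zero =>
    intro u h
    rw [wordPow_zero, List.suffix_nil] at h
    exact ⟨[], 0, by simp [h, wordPow_zero]⟩
  | succ k ih =>
    rintro u ⟨s, h⟩
    rw [wordPow_succ', List.append_eq_append_iff] at h
    rcases h with ⟨a, h1, rfl⟩ | ⟨c, -, h2⟩
    · obtain ⟨s', j, rfl, hs'⟩ := ih ⟨s, h1.symm⟩
      exact ⟨s', j + 1, by rw [wordPow_succ', List.append_assoc], hs'⟩
    · exact ⟨u, 0, by simp [wordPow_zero], by simp [h2]⟩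

theorem exists_eq_append_of_prefix_wordPow {m : ℕ} {v : List (Fin m)} {k : ℕ} :
    ∀ {u : List (Fin m)}, u <+: wordPow v k →
      ∃ j t, u = wordPow v j ++ t ∧ t.length ≤ v.length := by
  induction k with
  | zero =>
    intro u h
    rw [wordPow_zero, List.prefix_nil] at h
    exact ⟨0, [], by simp [h, wordPow_zero]⟩
  | succ k ih =>
    rintro u ⟨t, h⟩
    rw [wordPow_succ, List.append_eq_append_iff] at h
    rcases h with ⟨a, h1, -⟩ | ⟨c, rfl, h2⟩
    · exact ⟨0, u, by simp [wordPow_zero], by simp [h1]⟩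
    · obtain ⟨j, t', rfl, ht'⟩ := ih ⟨t, h2.symm⟩
      exact ⟨j + 1, t', by rw [wordPow_succ, List.append_assoc], ht'⟩

/-- Every word is a product of words from `S` that leave `S` when their last letter is removed, up
to a last factor outside `S`. -/
theorem exists_eq_flatten_append {α : Type*} {S : Set (List α)} (hS : [] ∉ S) (w : List α) :
    ∃ (us : List (List α)) (v : List α), w = us.flatten ++ v ∧ v ∉ S ∧
      ∀ u ∈ us, u ∈ S ∧ ∃ x a, u = x ++ [a] ∧ x ∉ S := by
  induction w using List.reverseRecOn with
  | nil => exact ⟨[], [], by simp, hS, by simp⟩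
  | append_singleton w a ih =>
    obtain ⟨us, v, rfl, hv, hus⟩ := ih
    by_cases h : v ++ [a] ∈ S
    · refine ⟨us ++ [v ++ [a]], [], by simp, hS, fun u hu => ?_⟩
      rcases List.mem_append.1 hu with hu | hu
      · exact hus u hu
      · rw [List.mem_singleton] at hu
        exact ⟨hu ▸ h, v, a, hu, hv⟩
    · exact ⟨us, v ++ [a], by simp, h, hus⟩

end Words

section PowerFactors
open scoped Matrix.Norms.L2Operator

theorem exists_norm_wordProd_le_of_length_le {m : ℕ} {n : Type} [Fintype n] [DecidableEq n]
    (A : Fin m → Matrix n n ℝ) (L : ℕ) :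
    ∃ C, 0 < C ∧ ∀ w : List (Fin m), w.length ≤ L → ‖wordProd A w‖ ≤ C := by
  obtain ⟨C, hC⟩ := ((List.finite_length_le (Fin m) L).image fun w => ‖wordProd A w‖).bddAbove
  exact ⟨max C 1, by positivity, fun w hw =>
    (hC (Set.mem_image_of_mem _ hw)).trans (le_max_left _ _)⟩

/-- If the powers of the product of `p` are bounded, then so are the products of all factors of
the powers of `p` and of its cyclic permutations: up to a bounded number of letters at both ends,
such a factor is a power of `p`. -/
theorem exists_norm_le_of_isFactorOfPower {m : ℕ} {n : Type} [Fintype n] [DecidableEq n]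
    (A : Fin m → Matrix n n ℝ) (p : List (Fin m)) {C : ℝ} (hC : ∀ k, ‖wordProd A p ^ k‖ ≤ C) :
    ∃ D, ∀ u, IsFactorOfPower p u → ‖wordProd A u‖ ≤ D := by
  have hC0 : 0 ≤ C := (norm_nonneg _).trans (hC 0)
  obtain ⟨E, hE0, hE⟩ := exists_norm_wordProd_le_of_length_le A p.length
  set G := max E (E * C * E) with hG
  have hG0 : 0 < G := lt_max_of_lt_left hE0
  have hrot : ∀ v, p.IsRotated v → ∀ k, ‖wordProd A v ^ k‖ ≤ G := by
    intro v hv k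
    obtain ⟨r, hr, rfl⟩ := List.isRotated_iff_mod.1 hv
    rcases k with _ | k
    · exact (hE [] (by simp)).trans (le_max_left _ _)
    · refine le_trans ?_ (le_max_right _ _)
      have hp : wordProd A p = wordProd A (p.take r) * wordProd A (p.drop r) := by
        rw [← wordProd_append, List.take_append_drop]
      rw [List.rotate_eq_drop_append_take hr, wordProd_append, pow_succ, ← mul_assoc,
        mul_pow_mul, ← hp]
      calc _ ≤ ‖wordProd A (p.drop r)‖ * ‖wordProd A p ^ k‖ * ‖wordProd A (p.take r)‖ :=
            (norm_mul_le _ _).trans (mul_le_mul_of_nonneg_right (norm_mul_le _ _)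
              (norm_nonneg _))
        _ ≤ E * C * E := by
            gcongr
            · exact hE _ (by simp)
            · exact hC k
            · exact hE _ (by simp)
  refine ⟨max E (E * G * E), ?_⟩
  rintro u ⟨v, hv, k, s, t, h⟩
  have hlen : v.length = p.length := hv.perm.length_eq.symm
  obtain ⟨s', j, hs', hlen'⟩ := exists_eq_append_of_suffix_wordPow (v := v) (k := k)
    (u := u ++ t) ⟨s, by rw [← h, List.append_assoc]⟩
  rw [List.append_eq_append_iff] at hs'
  rcases hs' with ⟨a, h1, -⟩ | ⟨c, rfl, h2⟩
  · refine (hE u ?_).trans (le_max_left _ _)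
    rw [h1, List.length_append, hlen] at hlen'
    omega
  · obtain ⟨i, t', rfl, ht'⟩ := exists_eq_append_of_prefix_wordPow (v := v) (k := j)
      (u := c) ⟨t, h2.symm⟩
    refine le_trans ?_ (le_max_right _ _)
    rw [wordProd_append, wordProd_append, wordProd_wordPow, ← mul_assoc]
    calc _ ≤ ‖wordProd A s'‖ * ‖wordProd A v ^ i‖ * ‖wordProd A t'‖ :=
          (norm_mul_le _ _).trans (mul_le_mul_of_nonneg_right (norm_mul_le _ _)
            (norm_nonneg _))
      _ ≤ E * G * E := by
          gcongr
          · exact hE _ (hlen'.trans hlen.le)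
          · exact hrot v hv i
          · exact hE _ (ht'.trans hlen.le)

end PowerFactors

/-! ### Block triangular families -/

section Blocks
open scoped Matrix.Norms.L2Operator

/-- The block upper triangular family with diagonal blocks `A₁ j`, `A₂ j` and upper right
block `B j`. -/
def blockFamily {m : ℕ} {n₁ n₂ : Type} (A₁ : Fin m → Matrix n₁ n₁ ℝ)
    (B : Fin m → Matrix n₁ n₂ ℝ) (A₂ : Fin m → Matrix n₂ n₂ ℝ) :
    Fin m → Matrix (n₁ ⊕ n₂) (n₁ ⊕ n₂) ℝ :=
  fun j => Matrix.fromBlocks (A₁ j) (B j) 0 (A₂ j)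

/-- The upper right block of the product of the block triangular family along a word. -/
def upperBlock {m : ℕ} {n₁ n₂ : Type} [Fintype n₁] [DecidableEq n₁] [Fintype n₂]
    [DecidableEq n₂] (A₁ : Fin m → Matrix n₁ n₁ ℝ) (B : Fin m → Matrix n₁ n₂ ℝ)
    (A₂ : Fin m → Matrix n₂ n₂ ℝ) (w : List (Fin m)) : Matrix n₁ n₂ ℝ :=
  (wordProd (blockFamily A₁ B A₂) w).toBlocks₁₂

theorem exists_norm_le_of_finite {ι E : Type*} [Finite ι] [NormedAddCommGroup E] (B : ι → E) :
    ∃ β, 0 < β ∧ ∀ a, ‖B a‖ ≤ β := by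
  obtain ⟨C, hC⟩ := (Set.finite_range fun a => ‖B a‖).bddAbove
  exact ⟨max C 1, by positivity, fun a => (hC ⟨a, rfl⟩).trans (le_max_left _ _)⟩

variable {m : ℕ} {n₁ n₂ : Type} [Fintype n₁] [DecidableEq n₁] [Fintype n₂] [DecidableEq n₂]
  {A₁ : Fin m → Matrix n₁ n₁ ℝ} {B : Fin m → Matrix n₁ n₂ ℝ} {A₂ : Fin m → Matrix n₂ n₂ ℝ}

theorem wordProd_blockFamily (A₁ : Fin m → Matrix n₁ n₁ ℝ) (B : Fin m → Matrix n₁ n₂ ℝ)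
    (A₂ : Fin m → Matrix n₂ n₂ ℝ) (w : List (Fin m)) :
    wordProd (blockFamily A₁ B A₂) w =
      Matrix.fromBlocks (wordProd A₁ w) (upperBlock A₁ B A₂ w) 0 (wordProd A₂ w) := by
  induction w with
  | nil => simp [upperBlock, wordProd_nil, ← Matrix.fromBlocks_one]
  | cons a w ih =>
    have h : wordProd (blockFamily A₁ B A₂) (a :: w) =
        Matrix.fromBlocks (A₁ a * wordProd A₁ w)
          (A₁ a * upperBlock A₁ B A₂ w + B a * wordProd A₂ w) 0 (A₂ a * wordProd A₂ w) := by
      rw [wordProd_cons, ih]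
      simp [blockFamily, Matrix.fromBlocks_multiply]
    rw [upperBlock, h, Matrix.toBlocks_fromBlocks₁₂, wordProd_cons, wordProd_cons]

theorem upperBlock_nil : upperBlock A₁ B A₂ [] = 0 := by
  simp [upperBlock, wordProd_nil, ← Matrix.fromBlocks_one]

theorem upperBlock_append (u w : List (Fin m)) :
    upperBlock A₁ B A₂ (u ++ w) =
      wordProd A₁ u * upperBlock A₁ B A₂ w + upperBlock A₁ B A₂ u * wordProd A₂ w := by
  rw [upperBlock, wordProd_append, wordProd_blockFamily, wordProd_blockFamily,
    Matrix.fromBlocks_multiply, Matrix.toBlocks_fromBlocks₁₂]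

theorem upperBlock_singleton (a : Fin m) : upperBlock A₁ B A₂ [a] = B a := by
  simp [upperBlock, wordProd_cons, wordProd_nil, blockFamily]

/-- The upper right block of a word of length `k` is a sum of `k` products in which one letter is
replaced by its block `B a`. The factor `A₁(u)` on the left makes the induction on `w` work. -/
theorem norm_mul_upperBlock_mul_le {C₁ C₂ β θ : ℝ} (hθ : 0 < θ)
    (hC₁ : ∀ w, ‖wordProd A₁ w‖ ≤ C₁ * θ ^ w.length)
    (hC₂ : ∀ w, ‖wordProd A₂ w‖ ≤ C₂ * θ ^ w.length) (hβ : ∀ a, ‖B a‖ ≤ β)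
    (u w : List (Fin m)) :
    ‖wordProd A₁ u * upperBlock A₁ B A₂ w‖ * θ ≤
      C₁ * β * C₂ * θ ^ (u.length + w.length) * w.length := by
  induction w generalizing u with
  | nil => simp [upperBlock_nil]
  | cons a w ih =>
    have h : wordProd A₁ u * upperBlock A₁ B A₂ (a :: w) =
        wordProd A₁ (u ++ [a]) * upperBlock A₁ B A₂ w +
          wordProd A₁ u * B a * wordProd A₂ w := by
      rw [← List.singleton_append, upperBlock_append, upperBlock_singleton, wordProd_append,
        Matrix.mul_add, Matrix.mul_assoc, Matrix.mul_assoc]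
    have hC₁0 := (norm_nonneg _).trans (hC₁ u)
    have hβ0 := (norm_nonneg _).trans (hβ a)
    have h2 : ‖wordProd A₁ u * B a * wordProd A₂ w‖ ≤
        C₁ * θ ^ u.length * β * (C₂ * θ ^ w.length) := by
      refine (Matrix.l2_opNorm_mul _ _).trans ?_
      refine mul_le_mul ((Matrix.l2_opNorm_mul _ _).trans ?_) (hC₂ w) (norm_nonneg _)
        (by positivity)
      exact mul_le_mul (hC₁ u) (hβ a) (norm_nonneg _) hC₁0
    have ih' := ih (u ++ [a])
    rw [List.length_append, List.length_singleton] at ih'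
    have hlen : u.length + (a :: w).length = u.length + 1 + w.length := by
      rw [List.length_cons]
      ring
    rw [h, hlen]
    calc _ ≤ ‖wordProd A₁ (u ++ [a]) * upperBlock A₁ B A₂ w‖ * θ +
          C₁ * θ ^ u.length * β * (C₂ * θ ^ w.length) * θ := by
          rw [← add_mul]
          exact mul_le_mul_of_nonneg_right ((norm_add_le _ _).trans (by gcongr)) hθ.le
      _ ≤ C₁ * β * C₂ * θ ^ (u.length + 1 + w.length) * w.length +
          C₁ * θ ^ u.length * β * (C₂ * θ ^ w.length) * θ := by gcongr
      _ = C₁ * β * C₂ * θ ^ (u.length + 1 + w.length) * (a :: w).length := by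
          rw [List.length_cons, pow_add, pow_add]
          push_cast
          ring

theorem exists_norm_upperBlock_le_mul_length {C₁ C₂ θ : ℝ} (hθ : 0 < θ)
    (hC₁ : ∀ w, ‖wordProd A₁ w‖ ≤ C₁ * θ ^ w.length)
    (hC₂ : ∀ w, ‖wordProd A₂ w‖ ≤ C₂ * θ ^ w.length) (B : Fin m → Matrix n₁ n₂ ℝ) :
    ∃ C, 0 ≤ C ∧ ∀ w, ‖upperBlock A₁ B A₂ w‖ ≤ C * θ ^ w.length * w.length := by
  obtain ⟨β, hβ0, hβ⟩ := exists_norm_le_of_finite B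
  have hC₁0 : 0 ≤ C₁ := by simpa using (norm_nonneg _).trans (hC₁ [])
  have hC₂0 : 0 ≤ C₂ := by simpa using (norm_nonneg _).trans (hC₂ [])
  refine ⟨C₁ * β * C₂ / θ, by positivity, fun w => ?_⟩
  have h := norm_mul_upperBlock_mul_le hθ hC₁ hC₂ hβ [] w
  rw [wordProd_nil, Matrix.one_mul, List.length_nil, zero_add, ← le_div_iff₀ hθ] at h
  refine h.trans (le_of_eq ?_)
  ring

/-- The rate of contraction may be replaced by any larger one, so that two contracting sets can be
given a common rate. -/
theorem IsContracting.exists_rate {n : Type} [Fintype n] [DecidableEq n]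
    {A : Fin m → Matrix n n ℝ} {S : Set (List (Fin m))} (h : IsContracting A S) :
    ∃ θ₀ : ℝ, θ₀ < 1 ∧ ∀ θ, θ₀ ≤ θ → ∃ C, 0 < C ∧ ∀ cs : List (List (Fin m)),
      ‖wordProd A cs.flatten‖ ≤ C * θ ^ (open Classical in cs.countP (· ∈ S)) := by
  obtain ⟨C, θ₀, hC0, hθ0, hθ1, hC⟩ := h
  refine ⟨θ₀, hθ1, fun θ hθ => ⟨C, hC0, fun cs => (hC cs).trans ?_⟩⟩
  gcongr

open Classical in
/-- The sum over the factors `c` of `A₁(prefix) Z(c) A₂(suffix)`. Writing `a` and `b` for the number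
of factors from `S₁` in `pre` and from `S₂` in `cs`, the bound `θ ^ a * (2 - θ ^ b) / (1 - θ)`
is reproduced when a factor from `S₁ ∪ S₂` is added in front of `cs`: a factor from `S₁` shrinks
the remaining sum, a factor from `S₂` only adds a term `θ ^ b`, which telescopes. -/
theorem norm_mul_upperBlock_flatten_le {S₁ S₂ : Set (List (Fin m))} {C₁ C₂ E θ : ℝ}
    (hC₁0 : 0 < C₁) (hC₂0 : 0 < C₂) (hE0 : 0 < E) (hθ0 : 0 < θ) (hθ1 : θ < 1)
    (hC₁ : ∀ cs : List (List (Fin m)),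
      ‖wordProd A₁ cs.flatten‖ ≤ C₁ * θ ^ cs.countP (· ∈ S₁))
    (hC₂ : ∀ cs : List (List (Fin m)),
      ‖wordProd A₂ cs.flatten‖ ≤ C₂ * θ ^ cs.countP (· ∈ S₂))
    (cs : List (List (Fin m)))
    (hcs : ∀ c ∈ cs, (c ∈ S₁ ∨ c ∈ S₂) ∧ ‖upperBlock A₁ B A₂ c‖ ≤ E)
    (pre : List (List (Fin m))) :
    ‖wordProd A₁ pre.flatten * upperBlock A₁ B A₂ cs.flatten‖ ≤
      C₁ * E * C₂ * θ ^ pre.countP (· ∈ S₁) * ((2 - θ ^ cs.countP (· ∈ S₂)) / (1 - θ)) := by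
  have h1θ : 0 < 1 - θ := by linarith
  induction cs generalizing pre with
  | nil =>
    simp only [List.flatten_nil, upperBlock_nil, Matrix.mul_zero, norm_zero, List.countP_nil,
      pow_zero]
    have : (0 : ℝ) ≤ 2 - 1 := by norm_num
    positivity
  | cons c cs ih =>
    have hc := hcs c List.mem_cons_self
    have ih' := ih (fun c hc => hcs c (List.mem_cons_of_mem _ hc)) (pre ++ [c])
    have hsplit : wordProd A₁ pre.flatten * upperBlock A₁ B A₂ (c :: cs).flatten =
        wordProd A₁ (pre ++ [c]).flatten * upperBlock A₁ B A₂ cs.flatten +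
          wordProd A₁ pre.flatten * upperBlock A₁ B A₂ c * wordProd A₂ cs.flatten := by
      rw [List.flatten_cons, upperBlock_append, List.flatten_append, wordProd_append,
        Matrix.mul_add, Matrix.mul_assoc, Matrix.mul_assoc]
      simp
    set a := pre.countP (· ∈ S₁) with ha
    set b := cs.countP (· ∈ S₂) with hb
    have hterm : ‖wordProd A₁ pre.flatten * upperBlock A₁ B A₂ c * wordProd A₂ cs.flatten‖ ≤
        C₁ * θ ^ a * E * (C₂ * θ ^ b) := by
      refine (Matrix.l2_opNorm_mul _ _).trans ?_
      refine mul_le_mul ((Matrix.l2_opNorm_mul _ _).trans ?_) (hC₂ cs) (norm_nonneg _)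
        (by positivity)
      exact mul_le_mul (hC₁ pre) hc.2 (norm_nonneg _) (by positivity)
    rw [hsplit]
    refine (norm_add_le _ _).trans ((add_le_add ih' hterm).trans ?_)
    have hx0 : 0 < θ ^ b := by positivity
    have hx1 : θ ^ b ≤ 1 := pow_le_one₀ hθ0.le hθ1.le
    have hK : 0 < C₁ * E * C₂ * θ ^ a := by positivity
    -- `s` and `t` are the factors by which `c` changes the powers of `θ` for `S₁` and `S₂`.
    suffices h : ∀ s t : ℝ, (s = θ ∨ s = 1) → (t = θ ∨ t = 1) → (s = θ ∨ t = θ) →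
        C₁ * E * C₂ * (θ ^ a * s) * ((2 - θ ^ b) / (1 - θ)) + C₁ * θ ^ a * E * (C₂ * θ ^ b) ≤
          C₁ * E * C₂ * θ ^ a * ((2 - θ ^ b * t) / (1 - θ)) by
      have hs := h (if c ∈ S₁ then θ else 1) (if c ∈ S₂ then θ else 1)
        (by split_ifs <;> simp) (by split_ifs <;> simp)
        (by rcases hc.1 with h | h <;> simp [h])
      have e1 : θ ^ (pre ++ [c]).countP (· ∈ S₁) = θ ^ a * (if c ∈ S₁ then θ else 1) := by
        rw [List.countP_append, pow_add, ← ha]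
        by_cases h : c ∈ S₁ <;> simp [h]
      have e2 : θ ^ (c :: cs).countP (· ∈ S₂) = θ ^ b * (if c ∈ S₂ then θ else 1) := by
        rw [List.countP_cons, pow_add, ← hb]
        by_cases h : c ∈ S₂ <;> simp [h]
      rw [e1, e2]
      exact hs
    intro s t hs ht hst
    have hmain : s * (2 - θ ^ b) + (1 - θ) * θ ^ b ≤ 2 - θ ^ b * t := by
      rcases hs with rfl | rfl <;> rcases ht with rfl | rfl
      · nlinarith
      · nlinarith
      · linarith
      · rcases hst with h | h <;> linarith
    have hmain' : s * ((2 - θ ^ b) / (1 - θ)) + θ ^ b ≤ (2 - θ ^ b * t) / (1 - θ) := by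
      rw [le_div_iff₀ h1θ]
      have : (s * ((2 - θ ^ b) / (1 - θ)) + θ ^ b) * (1 - θ) =
          s * (2 - θ ^ b) + (1 - θ) * θ ^ b := by
        field_simp
      linarith
    have := mul_le_mul_of_nonneg_left hmain' hK.le
    linarith

theorem IsContracting.exists_norm_le {n : Type} [Fintype n] [DecidableEq n]
    {A : Fin m → Matrix n n ℝ} {S : Set (List (Fin m))} (h : IsContracting A S) :
    ∃ C, 0 < C ∧ ∀ w, ‖wordProd A w‖ ≤ C := by
  obtain ⟨C, θ, hC0, hθ0, hθ1, hC⟩ := h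
  refine ⟨C, hC0, fun w => ?_⟩
  have h1 := hC [w]
  rw [List.flatten_singleton] at h1
  exact h1.trans (mul_le_of_le_one_right hC0.le (pow_le_one₀ hθ0.le hθ1.le))

/-- The upper right blocks of all products are bounded as soon as they are bounded on the words
outside `S₁ ∪ S₂`, where `S₁` and `S₂` are contracting for the two diagonal families. A word is
cut into minimal factors from `S₁ ∪ S₂`; the upper right block is the sum over the factors `c` of
`A₁(prefix) Z(c) A₂(suffix)`, and passing from one factor to the next either makes the bound for
the prefix smaller by a fixed rate or makes the bound for the suffix larger by this rate, so that
the sum is dominated by geometric series. -/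
theorem exists_norm_upperBlock_le {S₁ S₂ : Set (List (Fin m))} (h₁ : IsContracting A₁ S₁)
    (h₂ : IsContracting A₂ S₂) (hnil₁ : [] ∉ S₁) (hnil₂ : [] ∉ S₂) {D : ℝ}
    (hD : ∀ w, w ∉ S₁ → w ∉ S₂ → ‖upperBlock A₁ B A₂ w‖ ≤ D) :
    ∃ C, ∀ w, ‖upperBlock A₁ B A₂ w‖ ≤ C := by
  classical
  obtain ⟨F₁, hF₁0, hF₁⟩ := h₁.exists_norm_le
  obtain ⟨F₂, hF₂0, hF₂⟩ := h₂.exists_norm_le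
  obtain ⟨β, hβ0, hβ⟩ := exists_norm_le_of_finite B
  obtain ⟨r₁, hr₁, h₁⟩ := h₁.exists_rate
  obtain ⟨r₂, hr₂, h₂⟩ := h₂.exists_rate
  set θ := max (max r₁ r₂) (1 / 2)
  have hθ0 : 0 < θ := by positivity
  have hθ1 : θ < 1 := max_lt (max_lt hr₁ hr₂) (by norm_num)
  obtain ⟨C₁, hC₁0, hC₁⟩ := h₁ θ ((le_max_left _ _).trans (le_max_left _ _))
  obtain ⟨C₂, hC₂0, hC₂⟩ := h₂ θ ((le_max_right _ _).trans (le_max_left _ _))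
  have hD0 : 0 ≤ D := (norm_nonneg _).trans (hD [] hnil₁ hnil₂)
  set E := F₁ * β + D * F₂
  have hE0 : 0 < E := by positivity
  have h1θ : 0 < 1 - θ := by linarith
  refine ⟨F₁ * D + C₁ * E * C₂ * (2 / (1 - θ)) * F₂, fun w => ?_⟩
  obtain ⟨us, v, rfl, hv, hus⟩ := exists_eq_flatten_append (S := S₁ ∪ S₂)
    (by simp [hnil₁, hnil₂]) w
  have hus' : ∀ c ∈ us, (c ∈ S₁ ∨ c ∈ S₂) ∧ ‖upperBlock A₁ B A₂ c‖ ≤ E := by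
    intro c hc
    obtain ⟨hcS, x, a, rfl, hx⟩ := hus c hc
    refine ⟨hcS, ?_⟩
    rw [Set.mem_union, not_or] at hx
    rw [upperBlock_append, upperBlock_singleton]
    refine (norm_add_le _ _).trans (add_le_add ?_ ?_)
    · exact (Matrix.l2_opNorm_mul _ _).trans
        (mul_le_mul (hF₁ _) (hβ _) (norm_nonneg _) hF₁0.le)
    · exact (Matrix.l2_opNorm_mul _ _).trans
        (mul_le_mul (hD x hx.1 hx.2) (hF₂ _) (norm_nonneg _) hD0)
  have hsum := norm_mul_upperBlock_flatten_le hC₁0 hC₂0 hE0 hθ0 hθ1 hC₁ hC₂ us hus' []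
  rw [List.flatten_nil, wordProd_nil, Matrix.one_mul, List.countP_nil, pow_zero, mul_one] at hsum
  have hsum' : ‖upperBlock A₁ B A₂ us.flatten‖ ≤ C₁ * E * C₂ * (2 / (1 - θ)) := by
    refine hsum.trans ?_
    gcongr
    have : 0 < θ ^ us.countP (· ∈ S₂) := by positivity
    linarith
  rw [Set.mem_union, not_or] at hv
  rw [upperBlock_append]
  refine (norm_add_le _ _).trans (add_le_add ?_ ?_)
  · exact (Matrix.l2_opNorm_mul _ _).trans
      (mul_le_mul (hF₁ _) (hD v hv.1 hv.2) (norm_nonneg _) hF₁0.le)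
  · exact (Matrix.l2_opNorm_mul _ _).trans
      (mul_le_mul hsum' (hF₂ _) (norm_nonneg _) (by positivity))

/-- The norm of a block triangular matrix is bounded by the norms of its blocks. -/
theorem exists_norm_fromBlocks_le (n₁ n₂ : Type) [Fintype n₁] [DecidableEq n₁] [Fintype n₂]
    [DecidableEq n₂] :
    ∃ C, 0 < C ∧ ∀ (P : Matrix n₁ n₁ ℝ) (Z : Matrix n₁ n₂ ℝ) (Q : Matrix n₂ n₂ ℝ),
      ‖Matrix.fromBlocks P Z 0 Q‖ ≤ C * (‖P‖ + ‖Z‖ + ‖Q‖) := by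
  let f : Matrix n₁ n₁ ℝ × Matrix n₁ n₂ ℝ × Matrix n₂ n₂ ℝ →ₗ[ℝ] Matrix (n₁ ⊕ n₂) (n₁ ⊕ n₂) ℝ :=
    { toFun := fun x => Matrix.fromBlocks x.1 x.2.1 0 x.2.2
      map_add' := fun x y => by simp [Matrix.fromBlocks_add]
      map_smul' := fun c x => by simp [Matrix.fromBlocks_smul] }
  obtain ⟨C, hC0, hC⟩ := exists_norm_map_le f
  refine ⟨C, hC0, fun P Z Q => (hC (P, Z, Q)).trans ?_⟩
  have h1 := norm_nonneg P
  have h2 := norm_nonneg Z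
  have h3 := norm_nonneg Q
  gcongr
  rw [Prod.norm_def, Prod.norm_def]
  exact max_le (by linarith) (max_le (by linarith) (by linarith))

theorem exists_norm_blocks_le (n₁ n₂ : Type) [Fintype n₁] [DecidableEq n₁] [Fintype n₂]
    [DecidableEq n₂] :
    ∃ C, 0 < C ∧ ∀ (P : Matrix n₁ n₁ ℝ) (Z : Matrix n₁ n₂ ℝ) (Q : Matrix n₂ n₂ ℝ),
      ‖P‖ ≤ C * ‖Matrix.fromBlocks P Z 0 Q‖ ∧ ‖Z‖ ≤ C * ‖Matrix.fromBlocks P Z 0 Q‖ ∧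
        ‖Q‖ ≤ C * ‖Matrix.fromBlocks P Z 0 Q‖ := by
  let f : Matrix (n₁ ⊕ n₂) (n₁ ⊕ n₂) ℝ →ₗ[ℝ] Matrix n₁ n₁ ℝ × Matrix n₁ n₂ ℝ × Matrix n₂ n₂ ℝ :=
    { toFun := fun X => (X.toBlocks₁₁, X.toBlocks₁₂, X.toBlocks₂₂)
      map_add' := fun x y => rfl
      map_smul' := fun c x => rfl }
  obtain ⟨C, hC0, hC⟩ := exists_norm_map_le f
  refine ⟨C, hC0, fun P Z Q => ?_⟩
  have h := hC (Matrix.fromBlocks P Z 0 Q)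
  have hf : f (Matrix.fromBlocks P Z 0 Q) = (P, Z, Q) := rfl
  rw [hf, Prod.norm_def, Prod.norm_def] at h
  exact ⟨(le_max_left _ _).trans h, (le_max_left _ _).trans ((le_max_right _ _).trans h),
    (le_max_right _ _).trans ((le_max_right _ _).trans h)⟩

end Blocks

/-! ### Power boundedness and Jordan chains -/

section JordanChains
open scoped Matrix.Norms.L2Operator

variable {n : Type} [Fintype n] [DecidableEq n]

theorem mem_spectrum_iff_exists_mulVec {Q : Matrix n n ℂ} {z : ℂ} :
    z ∈ spectrum ℂ Q ↔ ∃ x, x ≠ 0 ∧ Q.mulVec x = z • x := by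
  rw [← Matrix.spectrum_toLin', ← Module.End.hasEigenvalue_iff_mem_spectrum]
  constructor
  · intro h
    obtain ⟨x, hx⟩ := h.exists_hasEigenvector
    exact ⟨x, hx.2, by simpa using hx.apply_eq_smul⟩
  · rintro ⟨x, hx, h⟩
    exact Module.End.hasEigenvalue_of_hasEigenvector
      ⟨Module.End.mem_eigenspace_iff.2 (by simpa using h), hx⟩

/-- A complex matrix is power bounded if each vector has a bounded orbit under its powers. -/
def IsPowerBounded (Q : Matrix n n ℂ) : Prop :=
  ∀ x : n → ℂ, ∃ C, ∀ k : ℕ, ‖(Q ^ k).mulVec x‖ ≤ C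

theorem pow_mulVec_of_eigenvector {Q : Matrix n n ℂ} {z : ℂ} {x : n → ℂ}
    (h : Q.mulVec x = z • x) (k : ℕ) : (Q ^ k).mulVec x = z ^ k • x := by
  induction k with
  | zero => simp
  | succ k ih =>
    rw [pow_succ, ← Matrix.mulVec_mulVec, h, Matrix.mulVec_smul, ih, smul_smul, pow_succ, mul_comm]

theorem pow_succ_mulVec_of_chain {Q : Matrix n n ℂ} {z : ℂ} {u v : n → ℂ}
    (hu : Q.mulVec u = z • u) (hv : Q.mulVec v = z • v + u) (k : ℕ) :
    (Q ^ (k + 1)).mulVec v = z ^ (k + 1) • v + ((k + 1 : ℕ) * z ^ k) • u := by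
  induction k with
  | zero => simp [hv]
  | succ k ih =>
    rw [pow_succ', ← Matrix.mulVec_mulVec, ih, Matrix.mulVec_add, Matrix.mulVec_smul,
      Matrix.mulVec_smul, hu, hv]
    push_cast
    module

theorem IsPowerBounded.norm_le_one {Q : Matrix n n ℂ} (hQ : IsPowerBounded Q) {z : ℂ}
    {x : n → ℂ} (hx : x ≠ 0) (h : Q.mulVec x = z • x) : ‖z‖ ≤ 1 := by
  by_contra! hz
  obtain ⟨C, hC⟩ := hQ x
  have hx0 : 0 < ‖x‖ := norm_pos_iff.2 hx
  obtain ⟨k, hk⟩ := pow_unbounded_of_one_lt (C / ‖x‖) hz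
  have := hC k
  rw [pow_mulVec_of_eigenvector h, norm_smul, norm_pow] at this
  rw [div_lt_iff₀ hx0] at hk
  linarith

theorem IsPowerBounded.norm_le_one_of_mem_spectrum {Q : Matrix n n ℂ} (hQ : IsPowerBounded Q)
    {z : ℂ} (hz : z ∈ spectrum ℂ Q) : ‖z‖ ≤ 1 := by
  obtain ⟨x, hx, h⟩ := mem_spectrum_iff_exists_mulVec.1 hz
  exact hQ.norm_le_one hx h

theorem norm_pow_succ_mulVec_ge {Q : Matrix n n ℂ} {z : ℂ} {u v : n → ℂ} (hz : ‖z‖ = 1)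
    (hu : Q.mulVec u = z • u) (hv : Q.mulVec v = z • v + u) (k : ℕ) :
    (k + 1 : ℕ) * ‖u‖ - ‖v‖ ≤ ‖(Q ^ (k + 1)).mulVec v‖ := by
  rw [pow_succ_mulVec_of_chain hu hv]
  have h := norm_sub_le (z ^ (k + 1) • v + ((k + 1 : ℕ) * z ^ k) • u) (z ^ (k + 1) • v)
  rw [add_sub_cancel_left, norm_smul, norm_smul, norm_mul, norm_pow, norm_pow, hz, one_pow,
    one_pow, Complex.norm_natCast] at h
  linarith

theorem IsPowerBounded.eq_zero_of_chain {Q : Matrix n n ℂ} (hQ : IsPowerBounded Q) {z : ℂ}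
    {u v : n → ℂ} (hz : ‖z‖ = 1) (hu : Q.mulVec u = z • u) (hv : Q.mulVec v = z • v + u) :
    u = 0 := by
  by_contra hne
  obtain ⟨C, hC⟩ := hQ v
  have hu0 : 0 < ‖u‖ := norm_pos_iff.2 hne
  obtain ⟨k, hk⟩ := exists_nat_gt ((C + ‖v‖) / ‖u‖)
  rw [div_lt_iff₀ hu0] at hk
  have h := (norm_pow_succ_mulVec_ge hz hu hv k).trans (hC _)
  push_cast at h
  linarith

/-- A matrix with all eigenvalues in the closed unit disc and without Jordan chains of length two
for eigenvalues on the unit circle is power bounded. -/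
theorem isPowerBounded_of_no_chain {Q : Matrix n n ℂ}
    (h1 : ∀ (z : ℂ) (x : n → ℂ), x ≠ 0 → Q.mulVec x = z • x → ‖z‖ ≤ 1)
    (h2 : ∀ (z : ℂ) (u v : n → ℂ), ‖z‖ = 1 → Q.mulVec u = z • u → Q.mulVec v = z • v + u →
      u = 0) : IsPowerBounded Q := by
  let W : Submodule ℂ (n → ℂ) :=
    { carrier := {x | ∃ C, ∀ k : ℕ, ‖(Q ^ k).mulVec x‖ ≤ C}
      add_mem' := by
        rintro x y ⟨C, hC⟩ ⟨D, hD⟩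
        refine ⟨C + D, fun k => ?_⟩
        rw [Matrix.mulVec_add]
        exact (norm_add_le _ _).trans (add_le_add (hC k) (hD k))
      zero_mem' := ⟨0, fun k => by simp⟩
      smul_mem' := by
        rintro c x ⟨C, hC⟩
        refine ⟨‖c‖ * C, fun k => ?_⟩
        rw [Matrix.mulVec_smul, norm_smul]
        exact mul_le_mul_of_nonneg_left (hC k) (norm_nonneg c) }
  have hW : ∀ x, x ∈ W ↔ ∃ C, ∀ k : ℕ, ‖(Q ^ k).mulVec x‖ ≤ C := fun x => Iff.rfl
  set f := Matrix.toLin' Q with hf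
  have hfx : ∀ (z : ℂ) (x : n → ℂ), (f - algebraMap ℂ _ z) x = Q.mulVec x - z • x := by
    intro z x
    simp [hf, Module.algebraMap_end_apply]
  -- Inside the unit disc the orbit of `x` is controlled by that of `(Q - z) x`.
  have hin : ∀ (z : ℂ), ‖z‖ < 1 → ∀ (k : ℕ) (x : n → ℂ),
      ((f - algebraMap ℂ _ z) ^ k) x = 0 → x ∈ W := by
    intro z hz k
    induction k with
    | zero =>
      intro x hx
      rw [pow_zero, Module.End.one_apply] at hx
      exact hx ▸ W.zero_mem
    | succ k ih =>
      intro x hx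
      rw [pow_succ, Module.End.mul_apply] at hx
      obtain ⟨C, hC⟩ := ih _ hx
      rw [hfx] at hC
      have hz' : 0 < 1 - ‖z‖ := by linarith
      refine ⟨max ‖x‖ (C / (1 - ‖z‖)), fun j => ?_⟩
      induction j with
      | zero => simp
      | succ j ihj =>
        have e : (Q ^ (j + 1)).mulVec x =
            z • (Q ^ j).mulVec x + (Q ^ j).mulVec (Q.mulVec x - z • x) := by
          rw [pow_succ, ← Matrix.mulVec_mulVec, Matrix.mulVec_sub, Matrix.mulVec_smul]
          abel
        rw [e]
        refine (norm_add_le _ _).trans ?_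
        rw [norm_smul]
        have hC' : C ≤ (1 - ‖z‖) * max ‖x‖ (C / (1 - ‖z‖)) := by
          rw [← div_le_iff₀' hz']
          exact le_max_right _ _
        nlinarith [hC j, norm_nonneg z]
  -- On the unit circle every generalized eigenvector is an eigenvector.
  have hon : ∀ (z : ℂ), ‖z‖ = 1 → ∀ (k : ℕ) (x : n → ℂ),
      ((f - algebraMap ℂ _ z) ^ k) x = 0 → Q.mulVec x = z • x := by
    intro z hz k
    induction k with
    | zero =>
      intro x hx
      rw [pow_zero, Module.End.one_apply] at hx
      simp [hx]
    | succ k ih =>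
      intro x hx
      rw [pow_succ, Module.End.mul_apply] at hx
      have hw := ih _ hx
      rw [hfx] at hw
      exact sub_eq_zero.1 (h2 z _ x hz hw (by abel))
  have hout : ∀ (z : ℂ), 1 < ‖z‖ → ∀ (k : ℕ) (x : n → ℂ),
      ((f - algebraMap ℂ _ z) ^ k) x = 0 → x = 0 := by
    intro z hz k
    induction k with
    | zero =>
      intro x hx
      simpa using hx
    | succ k ih =>
      intro x hx
      rw [pow_succ, Module.End.mul_apply] at hx
      have hw := ih _ hx
      rw [hfx, sub_eq_zero] at hw
      by_contra hne
      exact absurd (h1 z x hne hw) (not_le.2 hz)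
  have htop : (⊤ : Submodule ℂ (n → ℂ)) ≤ W := by
    rw [← Module.End.iSup_maxGenEigenspace_eq_top f]
    refine iSup_le fun z x hx => ?_
    obtain ⟨k, hk⟩ := (Module.End.mem_maxGenEigenspace f z x).1 hx
    rw [← Algebra.algebraMap_eq_smul_one] at hk
    rcases lt_trichotomy ‖z‖ 1 with hz | hz | hz
    · exact hin z hz k x hk
    · refine ⟨‖x‖, fun j => ?_⟩
      rw [pow_mulVec_of_eigenvector (hon z hz k x hk), norm_smul, norm_pow, hz, one_pow, one_mul]
    · rw [hout z hz k x hk]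
      exact W.zero_mem
  exact fun x => (hW x).1 (htop Submodule.mem_top)

theorem exists_norm_complexify_mulVec_le (x : n → ℂ) :
    ∃ C, 0 < C ∧ ∀ M : Matrix n n ℝ, ‖(complexify M).mulVec x‖ ≤ C * ‖M‖ := by
  let f : Matrix n n ℝ →ₗ[ℝ] (n → ℂ) :=
    { toFun := fun M => (complexify M).mulVec x
      map_add' := fun M N => by
        rw [← Matrix.add_mulVec]
        congr 1
        ext i j
        simp [complexify]
      map_smul' := fun c M => by
        ext i
        simp [complexify, Matrix.mulVec, dotProduct, Finset.mul_sum, mul_assoc] }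
  exact exists_norm_map_le f

theorem isPowerBounded_complexify {M : Matrix n n ℝ} {C : ℝ} (hC : ∀ k : ℕ, ‖M ^ k‖ ≤ C) :
    IsPowerBounded (complexify M) := by
  intro x
  obtain ⟨D, hD0, hD⟩ := exists_norm_complexify_mulVec_le x
  refine ⟨D * C, fun k => ?_⟩
  rw [← complexify_pow]
  exact (hD _).trans (mul_le_mul_of_nonneg_left (hC k) hD0.le)

theorem IsPowerBounded.exists_norm_pow_le {M : Matrix n n ℝ}
    (h : IsPowerBounded (complexify M)) : ∃ C, ∀ k : ℕ, ‖M ^ k‖ ≤ C := by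
  refine exists_norm_le_of_entries _ fun i j => ?_
  obtain ⟨C, hC⟩ := h (Pi.single j 1)
  refine ⟨C, fun k => ?_⟩
  have := (norm_le_pi_norm _ i).trans (hC k)
  rw [← complexify_pow] at this
  simpa [complexify] using this

/-- If a block triangular matrix is not power bounded although its diagonal blocks are, then it has
a Jordan chain for an eigenvalue of modulus one that is shared by both diagonal blocks. -/
theorem exists_chain_of_not_isPowerBounded {n₁ n₂ : Type} [Fintype n₁] [DecidableEq n₁]
    [Fintype n₂] [DecidableEq n₂] {P : Matrix n₁ n₁ ℂ} {Z : Matrix n₁ n₂ ℂ} {Q : Matrix n₂ n₂ ℂ}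
    (hP : IsPowerBounded P) (hQ : IsPowerBounded Q)
    (h : ¬ IsPowerBounded (Matrix.fromBlocks P Z 0 Q)) :
    ∃ z : ℂ, ‖z‖ = 1 ∧ z ∈ spectrum ℂ P ∧ z ∈ spectrum ℂ Q ∧
      ∃ u v : n₁ ⊕ n₂ → ℂ, u ≠ 0 ∧ (Matrix.fromBlocks P Z 0 Q).mulVec u = z • u ∧
        (Matrix.fromBlocks P Z 0 Q).mulVec v = z • v + u := by
  have hinl : ∀ {x y : n₁ ⊕ n₂ → ℂ}, (Matrix.fromBlocks P Z 0 Q).mulVec x = y →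
      P.mulVec (x ∘ Sum.inl) + Z.mulVec (x ∘ Sum.inr) = y ∘ Sum.inl := by
    rintro x y rfl
    rw [Matrix.fromBlocks_mulVec, Sum.elim_comp_inl]
  have hinr : ∀ {x y : n₁ ⊕ n₂ → ℂ}, (Matrix.fromBlocks P Z 0 Q).mulVec x = y →
      Q.mulVec (x ∘ Sum.inr) = y ∘ Sum.inr := by
    rintro x y rfl
    rw [Matrix.fromBlocks_mulVec, Sum.elim_comp_inr, Matrix.zero_mulVec, zero_add]
  have hzero : ∀ {x : n₁ ⊕ n₂ → ℂ}, x ∘ Sum.inl = 0 → x ∘ Sum.inr = 0 → x = 0 := by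
    intro x h1 h2
    ext (i | i)
    · exact congrFun h1 i
    · exact congrFun h2 i
  by_contra! hno
  refine h (isPowerBounded_of_no_chain ?_ ?_)
  · intro z x hx hzx
    by_cases hr : x ∘ Sum.inr = 0
    · have hl : x ∘ Sum.inl ≠ 0 := fun hl => hx (hzero hl hr)
      have h1 := hinl hzx
      rw [hr, Matrix.mulVec_zero, add_zero] at h1
      exact hP.norm_le_one hl h1
    · exact hQ.norm_le_one hr (hinr hzx)
  · intro z u v hz hu hv
    by_contra hne
    have hQu : Q.mulVec (u ∘ Sum.inr) = z • (u ∘ Sum.inr) := hinr hu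
    have hQv : Q.mulVec (v ∘ Sum.inr) = z • (v ∘ Sum.inr) + u ∘ Sum.inr := hinr hv
    have hur : u ∘ Sum.inr = 0 := hQ.eq_zero_of_chain hz hQu hQv
    have hul : u ∘ Sum.inl ≠ 0 := fun hl => hne (hzero hl hur)
    have hPu : P.mulVec (u ∘ Sum.inl) = z • (u ∘ Sum.inl) := by
      have h1 := hinl hu
      rwa [hur, Matrix.mulVec_zero, add_zero] at h1
    have hzP : z ∈ spectrum ℂ P := mem_spectrum_iff_exists_mulVec.2 ⟨_, hul, hPu⟩
    have hvr : v ∘ Sum.inr ≠ 0 := by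
      intro hvr
      have h1 := hinl hv
      rw [hvr, Matrix.mulVec_zero, add_zero] at h1
      exact hul (hP.eq_zero_of_chain hz hPu h1)
    have hzQ : z ∈ spectrum ℂ Q := by
      rw [hur, add_zero] at hQv
      exact mem_spectrum_iff_exists_mulVec.2 ⟨_, hvr, hQv⟩
    exact hno z hz hzP hzQ u v hne hu hv

end JordanChains

/-! ### Change of basis -/

section ChangeOfBasis
open scoped Matrix.Norms.L2Operator

variable {m : ℕ} {n n' : Type} [Fintype n] [Fintype n'] [DecidableEq n']
  {A : Fin m → Matrix n n ℝ} {F : Fin m → Matrix n' n' ℝ} {S : Matrix n n' ℝ} {S' : Matrix n' n ℝ}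

theorem wordProd_eq_conj [DecidableEq n] (hSS' : S * S' = 1) (hS'S : S' * S = 1)
    (hA : ∀ j, A j = S * F j * S')
    (w : List (Fin m)) : wordProd A w = S * wordProd F w * S' := by
  induction w with
  | nil => simp [wordProd_nil, hSS']
  | cons a w ih =>
    rw [wordProd_cons, wordProd_cons, ih, hA]
    calc S * F a * S' * (S * wordProd F w * S')
        = S * F a * (S' * S) * wordProd F w * S' := by simp only [Matrix.mul_assoc]
      _ = S * (F a * wordProd F w) * S' := by
          rw [hS'S, Matrix.mul_one, Matrix.mul_assoc S]

theorem eq_conj_symm (hS'S : S' * S = 1) (hA : ∀ j, A j = S * F j * S') (j : Fin m) :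
    F j = S' * A j * S := by
  rw [hA]
  calc F j = S' * S * F j * (S' * S) := by rw [hS'S, Matrix.one_mul, Matrix.mul_one]
    _ = S' * (S * F j * S') * S := by simp only [Matrix.mul_assoc]

theorem exists_norm_wordProd_conj_le [DecidableEq n] (hSS' : S * S' = 1) (hS'S : S' * S = 1)
    (hA : ∀ j, A j = S * F j * S') :
    ∃ C, 0 < C ∧ ∀ w, ‖wordProd A w‖ ≤ C * ‖wordProd F w‖ := by
  refine ⟨‖S‖ * ‖S'‖ + 1, by positivity, fun w => ?_⟩
  rw [wordProd_eq_conj hSS' hS'S hA]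
  calc ‖S * wordProd F w * S'‖ ≤ ‖S‖ * ‖wordProd F w‖ * ‖S'‖ :=
        (Matrix.l2_opNorm_mul _ _).trans
          (mul_le_mul_of_nonneg_right (Matrix.l2_opNorm_mul _ _) (norm_nonneg _))
    _ ≤ (‖S‖ * ‖S'‖ + 1) * ‖wordProd F w‖ := by nlinarith [norm_nonneg (wordProd F w)]

theorem hasNontrivialJordanBlock_conj {M : Matrix n n ℝ} {N : Matrix n' n' ℝ}
    (hS'S : S' * S = 1) (hM : M = S * N * S') {z : ℂ} (h : HasNontrivialJordanBlock N z) :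
    HasNontrivialJordanBlock M z := by
  obtain ⟨u, v, hu0, hu, hv⟩ := h
  set T := S.map Complex.ofRealHom with hT
  set T' := S'.map Complex.ofRealHom with hT'
  have hT'T : T' * T = 1 := by
    rw [hT, hT', ← Matrix.map_mul, hS'S, Matrix.map_one _ (map_zero _) (map_one _)]
  have hMT : complexify M * T = T * complexify N := by
    have : complexify M = T * complexify N * T' := by
      rw [hM, hT, hT']
      exact (Matrix.map_mul (f := Complex.ofRealHom)).trans
        (congrArg (· * _) (Matrix.map_mul (f := Complex.ofRealHom)))
    rw [this, Matrix.mul_assoc, hT'T, Matrix.mul_one]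
  refine ⟨T.mulVec u, T.mulVec v, fun h0 => hu0 ?_, ?_, ?_⟩
  · have := congrArg T'.mulVec h0
    rwa [Matrix.mulVec_mulVec, hT'T, Matrix.one_mulVec, Matrix.mulVec_zero] at this
  · rw [Matrix.mulVec_mulVec, hMT, ← Matrix.mulVec_mulVec, hu, Matrix.mulVec_smul]
  · rw [Matrix.mulVec_mulVec, hMT, ← Matrix.mulVec_mulVec, hv, Matrix.mulVec_add,
      Matrix.mulVec_smul]

theorem exists_conj_of_toMatrix_eq {d : ℕ} {n' : Type} [Fintype n'] [DecidableEq n']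
    {A : Fin m → Matrix (Fin d) (Fin d) ℝ} {F : Fin m → Matrix n' n' ℝ}
    (b : Module.Basis n' ℝ (Fin d → ℝ))
    (h : ∀ j, LinearMap.toMatrix b b (Matrix.toLin' (A j)) = F j) :
    ∃ (S : Matrix (Fin d) n' ℝ) (S' : Matrix n' (Fin d) ℝ), S * S' = 1 ∧ S' * S = 1 ∧
      ∀ j, A j = S * F j * S' := by
  refine ⟨(Pi.basisFun ℝ (Fin d)).toMatrix b, b.toMatrix (Pi.basisFun ℝ (Fin d)),
    Module.Basis.toMatrix_mul_toMatrix_flip _ _, Module.Basis.toMatrix_mul_toMatrix_flip _ _,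
    fun j => ?_⟩
  rw [← h, basis_toMatrix_mul_linearMap_toMatrix_mul_basis_toMatrix]
  exact (LinearMap.toMatrix'_toLin' (A j)).symm

end ChangeOfBasis

/-! ### Trajectories and growth -/

section Trajectories
open scoped Matrix.Norms.L2Operator

variable {m : ℕ} {n : Type} [Fintype n] [DecidableEq n] {A : Fin m → Matrix n n ℝ}

/-- The trajectory of a switching law: the factors accumulate on the left, so the word of the
first `k` letters is reversed. -/
theorem isTrajectory_wordProd_reverse (σ : ℕ → Fin m) (x₀ : n → ℝ) :
    IsTrajectory A fun k => (wordProd A ((List.range k).map σ).reverse).mulVec x₀ := by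
  refine ⟨σ, fun k => ?_⟩
  have h : ((List.range (k + 1)).map σ).reverse = σ k :: ((List.range k).map σ).reverse := by
    simp [List.range_succ]
  simp only [h, wordProd_cons, Matrix.mulVec_mulVec]

theorem IsTrajectory.bounded {C : ℝ} (hC : ∀ w, ‖wordProd A w‖ ≤ C) {x : ℕ → n → ℝ}
    (hx : IsTrajectory A x) : ∃ D, ∀ k, ‖x k‖ ≤ D := by
  obtain ⟨σ, hσ⟩ := hx
  obtain ⟨E, hE0, hE⟩ := exists_norm_mulVec_le (n := n)
  refine ⟨E * C * ‖x 0‖, fun k => ?_⟩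
  have h : ∃ w, x k = (wordProd A w).mulVec (x 0) := by
    induction k with
    | zero => exact ⟨[], by simp [wordProd_nil]⟩
    | succ k ih =>
      obtain ⟨w, hw⟩ := ih
      exact ⟨σ k :: w, by rw [hσ, hw, wordProd_cons, Matrix.mulVec_mulVec]⟩
  obtain ⟨w, hw⟩ := h
  rw [hw]
  refine (hE _ _).trans ?_
  gcongr
  exact hC w

theorem map_range_periodic (p : List (Fin m)) (σ : ℕ → Fin m)
    (hσ : ∀ i, p[i % p.length]? = some (σ i)) (k : ℕ) :
    (List.range (k * p.length)).map σ = wordPow p k := by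
  refine List.ext_getElem? fun i => ?_
  rcases lt_or_ge i (k * p.length) with hi | hi
  · rw [getElem?_wordPow _ _ _ hi, hσ, List.getElem?_map, List.getElem?_range hi]
    rfl
  · rw [List.getElem?_eq_none (by simpa using hi),
      List.getElem?_eq_none (by simpa [length_wordPow] using hi)]

theorem wordPow_reverse (p : List (Fin m)) (k : ℕ) :
    (wordPow p k).reverse = wordPow p.reverse k := by
  induction k with
  | zero => rfl
  | succ k ih => rw [wordPow_succ, wordPow_succ', List.reverse_append, ih]

/-- If all trajectories are bounded, then so are the powers of each product: they act on the
trajectories of periodic switching laws. -/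
theorem exists_norm_pow_le_of_bounded_trajectories
    (h : ∀ x : ℕ → n → ℝ, IsTrajectory A x → ∃ C : ℝ, ∀ k, ‖x k‖ ≤ C) {p : List (Fin m)}
    (hp : p ≠ []) : ∃ C, ∀ k, ‖wordProd A p ^ k‖ ≤ C := by
  have hlen : 0 < p.reverse.length := by simpa using List.length_pos_of_ne_nil hp
  set σ : ℕ → Fin m := fun i => p.reverse[i % p.reverse.length]'(Nat.mod_lt _ hlen)
  have hσ : ∀ i, p.reverse[i % p.reverse.length]? = some (σ i) := fun i =>
    List.getElem?_eq_getElem _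
  refine exists_norm_le_of_entries _ fun i j => ?_
  obtain ⟨C, hC⟩ := h _ (isTrajectory_wordProd_reverse σ (Pi.single j 1))
  refine ⟨C, fun k => ?_⟩
  have h1 := (norm_le_pi_norm _ i).trans (hC (k * p.reverse.length))
  rw [map_range_periodic _ _ hσ, wordPow_reverse, List.reverse_reverse, wordProd_wordPow] at h1
  simpa using h1

/-- A Jordan chain for an eigenvalue of modulus one makes the powers grow at least linearly. -/
theorem exists_mul_le_norm_pow {M : Matrix n n ℝ} {z : ℂ} (hz : ‖z‖ = 1)
    (h : HasNontrivialJordanBlock M z) : ∃ c, 0 < c ∧ ∀ k : ℕ, c * k ≤ ‖M ^ k‖ := by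
  obtain ⟨u, v, hu0, hu, hv⟩ := h
  have hu0' : 0 < ‖u‖ := norm_pos_iff.2 hu0
  obtain ⟨D, hD0, hD⟩ := exists_norm_complexify_mulVec_le u
  obtain ⟨E, hE0, hE⟩ := exists_norm_complexify_mulVec_le v
  -- `‖u‖ ≤ D ‖M ^ k‖` absorbs the constant term of `k ‖u‖ - ‖v‖ ≤ E ‖M ^ k‖`.
  refine ⟨‖u‖ ^ 2 / (E * ‖u‖ + D * ‖v‖), by positivity, fun k => ?_⟩
  rcases k with _ | k
  · simp
  have h1 : ‖u‖ ≤ D * ‖M ^ (k + 1)‖ := by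
    have := hD (M ^ (k + 1))
    rwa [complexify_pow, pow_mulVec_of_eigenvector hu, norm_smul, norm_pow, hz, one_pow,
      one_mul] at this
  have h2 : (k + 1 : ℕ) * ‖u‖ - ‖v‖ ≤ E * ‖M ^ (k + 1)‖ := by
    have := hE (M ^ (k + 1))
    rw [complexify_pow] at this
    exact (norm_pow_succ_mulVec_ge hz hu hv k).trans this
  rw [div_mul_eq_mul_div, div_le_iff₀ (by positivity)]
  nlinarith [norm_nonneg v]

/-- Linear growth along the powers of one word gives linear growth for all lengths, by
submultiplicativity of `maxNorm`. -/
theorem exists_mul_le_maxNorm {p : List (Fin m)} (hp : p ≠ []) {c : ℝ} (hc : 0 < c)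
    (h : ∀ k : ℕ, c * k ≤ ‖wordProd A p ^ k‖) : ∃ c', 0 < c' ∧ ∀ k : ℕ, c' * k ≤ maxNorm A k := by
  have hlen : 0 < p.length := List.length_pos_of_ne_nil hp
  obtain ⟨D, hD0, hD⟩ := exists_norm_wordProd_le_of_length_le A p.length
  refine ⟨c / (p.length * D), by positivity, fun k => ?_⟩
  obtain ⟨s, hs⟩ : ∃ s, (k / p.length + 1) * p.length = k + s := by
    refine Nat.exists_eq_add_of_le ?_
    have := Nat.div_add_mod' k p.length
    have := Nat.mod_lt k hlen
    linarith [add_mul (k / p.length) 1 p.length]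
  have hs' : s ≤ p.length := by
    have h1 := Nat.div_mul_le_self k p.length
    have h2 := add_mul (k / p.length) 1 p.length
    omega
  have h1 : maxNorm A ((k / p.length + 1) * p.length) ≤ maxNorm A k * D := by
    rw [hs]
    refine (maxNorm_add_le A k s).trans (mul_le_mul_of_nonneg_left ?_ (maxNorm_nonneg A k))
    exact maxNorm_le hD0.le fun w hw => hD w (hw.trans_le hs')
  have h2 := norm_wordProd_le_maxNorm A (wordPow p (k / p.length + 1))
  rw [wordProd_wordPow, length_wordPow] at h2
  have h3 := (h _).trans (h2.trans h1)
  have h4 : (k : ℝ) ≤ ((k / p.length + 1 : ℕ) : ℝ) * p.length := by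
    exact_mod_cast (Nat.le_add_right k s).trans hs.ge
  rw [div_mul_eq_mul_div, div_le_iff₀ (by positivity)]
  calc c * k ≤ c * (((k / p.length + 1 : ℕ) : ℝ) * p.length) := by gcongr
    _ = c * ((k / p.length + 1 : ℕ) : ℝ) * p.length := by ring
    _ ≤ maxNorm A k * D * p.length := by gcongr
    _ = maxNorm A k * (p.length * D) := by ring

end Trajectories

/-! ### The resonance criterion -/

section Resonance
open scoped Matrix.Norms.L2Operator

variable {m : ℕ} {n n₁ n₂ : Type} [Fintype n] [DecidableEq n] [Fintype n₁] [DecidableEq n₁]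
  [Fintype n₂] [DecidableEq n₂] {A : Fin m → Matrix n n ℝ}
  {A₁ : Fin m → Matrix n₁ n₁ ℝ} {B : Fin m → Matrix n₁ n₂ ℝ} {A₂ : Fin m → Matrix n₂ n₂ ℝ}
  {S : Matrix n (n₁ ⊕ n₂) ℝ} {S' : Matrix (n₁ ⊕ n₂) n ℝ} {p₁ p₂ : List (Fin m)}

theorem exists_norm_wordProd_le_add (hSS' : S * S' = 1) (hS'S : S' * S = 1)
    (hA : ∀ j, A j = S * blockFamily A₁ B A₂ j * S') :
    ∃ C, 0 < C ∧ ∀ w, ‖wordProd A w‖ ≤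
      C * (‖wordProd A₁ w‖ + ‖upperBlock A₁ B A₂ w‖ + ‖wordProd A₂ w‖) := by
  obtain ⟨C, hC0, hC⟩ := exists_norm_wordProd_conj_le hSS' hS'S hA
  obtain ⟨D, hD0, hD⟩ := exists_norm_fromBlocks_le n₁ n₂
  refine ⟨C * D, by positivity, fun w => (hC w).trans ?_⟩
  rw [wordProd_blockFamily, mul_assoc]
  exact mul_le_mul_of_nonneg_left (hD _ _ _) hC0.le

theorem jointSpectralRadius_blocks_le_one (hSS' : S * S' = 1) (hS'S : S' * S = 1)
    (hA : ∀ j, A j = S * blockFamily A₁ B A₂ j * S') (hrho : jointSpectralRadius A = 1) :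
    jointSpectralRadius A₁ ≤ 1 ∧ jointSpectralRadius A₂ ≤ 1 := by
  obtain ⟨C, hC0, hC⟩ := exists_norm_wordProd_conj_le hS'S hSS' (eq_conj_symm hS'S hA)
  obtain ⟨D, hD0, hD⟩ := exists_norm_blocks_le n₁ n₂
  have key : ∀ r : ℝ, 1 < r → jointSpectralRadius A₁ ≤ r ∧ jointSpectralRadius A₂ ≤ r := by
    intro r hr
    obtain ⟨E, hE0, hE⟩ := exists_maxNorm_le_mul_pow (hrho.trans_lt hr)
    have h : ∀ w : List (Fin m), D * ‖wordProd (blockFamily A₁ B A₂) w‖ ≤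
        D * C * E * r ^ w.length := by
      intro w
      calc D * ‖wordProd (blockFamily A₁ B A₂) w‖ ≤ D * (C * (E * r ^ w.length)) := by
            gcongr
            refine (hC w).trans ?_
            gcongr
            exact (norm_wordProd_le_maxNorm A w).trans (hE _)
        _ = _ := by ring
    simp only [wordProd_blockFamily] at h
    constructor
    · refine jointSpectralRadius_le_of_maxNorm_le (C := D * C * E) (by positivity)
        (by positivity) fun k => maxNorm_le (by positivity) fun w hw => ?_
      rw [← hw]
      exact (hD _ _ _).1.trans (h w)
    · refine jointSpectralRadius_le_of_maxNorm_le (C := D * C * E) (by positivity)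
        (by positivity) fun k => maxNorm_le (by positivity) fun w hw => ?_
      rw [← hw]
      exact (hD _ _ _).2.2.trans (h w)
  exact ⟨le_of_forall_gt_imp_ge_of_dense fun r hr => (key r hr).1,
    le_of_forall_gt_imp_ge_of_dense fun r hr => (key r hr).2⟩

theorem jointSpectralRadius_lt_one_of_blocks (hSS' : S * S' = 1) (hS'S : S' * S = 1)
    (hA : ∀ j, A j = S * blockFamily A₁ B A₂ j * S') (h₁ : jointSpectralRadius A₁ < 1)
    (h₂ : jointSpectralRadius A₂ < 1) : jointSpectralRadius A < 1 := by
  obtain ⟨θ, hθ, hθ1⟩ := exists_between (max_lt h₁ h₂)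
  have hθ0 : 0 < θ := (jointSpectralRadius_nonneg A₁).trans_lt ((le_max_left _ _).trans_lt hθ)
  obtain ⟨C₁, hC₁0, hC₁⟩ := exists_maxNorm_le_mul_pow ((le_max_left _ _).trans_lt hθ)
  obtain ⟨C₂, hC₂0, hC₂⟩ := exists_maxNorm_le_mul_pow ((le_max_right _ _).trans_lt hθ)
  have hC₁' : ∀ w, ‖wordProd A₁ w‖ ≤ C₁ * θ ^ w.length := fun w =>
    (norm_wordProd_le_maxNorm A₁ w).trans (hC₁ _)
  have hC₂' : ∀ w, ‖wordProd A₂ w‖ ≤ C₂ * θ ^ w.length := fun w =>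
    (norm_wordProd_le_maxNorm A₂ w).trans (hC₂ _)
  obtain ⟨D, hD0, hD⟩ := exists_norm_upperBlock_le_mul_length hθ0 hC₁' hC₂' B
  obtain ⟨C, hC0, hC⟩ := exists_norm_wordProd_le_add hSS' hS'S hA
  have hle : ∀ k : ℕ, maxNorm A k ≤
      C * (C₁ + C₂) * ((k : ℝ) ^ 0 * θ ^ k) + C * D * ((k : ℝ) ^ 1 * θ ^ k) := by
    intro k
    refine maxNorm_le (by positivity) fun w hw => (hC w).trans ?_
    calc _ ≤ C * (C₁ * θ ^ w.length + D * θ ^ w.length * w.length + C₂ * θ ^ w.length) := by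
          gcongr
          · exact hC₁' w
          · exact hD w
          · exact hC₂' w
      _ = _ := by rw [hw]; ring
  have hlim := ((tendsto_pow_const_mul_const_pow_of_lt_one 0 hθ0.le hθ1).const_mul
    (C * (C₁ + C₂))).add ((tendsto_pow_const_mul_const_pow_of_lt_one 1 hθ0.le hθ1).const_mul
    (C * D))
  rw [mul_zero, mul_zero, add_zero] at hlim
  obtain ⟨N, hN, hN0⟩ := ((hlim.eventually_lt_const (zero_lt_one' ℝ)).and
    (Filter.eventually_ge_atTop 1)).exists
  exact jointSpectralRadius_lt_one (by omega) ((hle N).trans_lt hN)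

theorem isContracting_empty {C : ℝ} (hC0 : 0 < C) (hC : ∀ w, ‖wordProd A w‖ ≤ C) :
    IsContracting A ∅ :=
  ⟨C, 1 / 2, hC0, by norm_num, by norm_num, fun cs => by simpa using hC _⟩

theorem isFactorOfPower_nil (p : List (Fin m)) : IsFactorOfPower p [] :=
  ⟨p, List.IsRotated.refl p, 0, List.nil_infix⟩

/-- Without resonance the block triangular family generates a bounded semigroup. If both diagonal
families have joint spectral radius one, then the words that are factors of powers of both
dominant words have bounded upper right blocks: these words have bounded length if the dominant
words are not cyclic permutations of each other, and otherwise the product of the common dominant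
word is power bounded for lack of a Jordan chain. -/
theorem exists_norm_wordProd_le_of_not_resonance (hSS' : S * S' = 1) (hS'S : S' * S = 1)
    (hA : ∀ j, A j = S * blockFamily A₁ B A₂ j * S') (hrho : jointSpectralRadius A = 1)
    (hirr₁ : ¬ IsReducibleFamily A₁) (hirr₂ : ¬ IsReducibleFamily A₂)
    (hdom₁ : IsDominantWord A₁ p₁) (hdom₂ : IsDominantWord A₂ p₂)
    (hres : ¬ AreInJordanResonance A A₁ A₂ p₁ p₂) : ∃ C, ∀ w, ‖wordProd A w‖ ≤ C := by
  obtain ⟨hρ₁, hρ₂⟩ := jointSpectralRadius_blocks_le_one hSS' hS'S hA hrho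
  obtain ⟨C₁, hC₁0, hC₁⟩ := exists_norm_wordProd_le hirr₁ hρ₁
  obtain ⟨C₂, hC₂0, hC₂⟩ := exists_norm_wordProd_le hirr₂ hρ₂
  suffices h : ∃ D, ∀ w, ‖upperBlock A₁ B A₂ w‖ ≤ D by
    obtain ⟨D, hD⟩ := h
    obtain ⟨C, hC0, hC⟩ := exists_norm_wordProd_le_add hSS' hS'S hA
    refine ⟨C * (C₁ + D + C₂), fun w => (hC w).trans ?_⟩
    gcongr
    · exact hC₁ w
    · exact hD w
    · exact hC₂ w
  rcases hρ₁.lt_or_eq with hlt | hρ₁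
  · refine exists_norm_upperBlock_le (D := 0) (isContracting_of_jointSpectralRadius_lt_one hlt)
      (isContracting_empty hC₂0 hC₂) (by simp) (by simp) fun w hw _ => ?_
    have hw' : w = [] := by simpa using hw
    simp [hw', upperBlock_nil]
  rcases hρ₂.lt_or_eq with hlt | hρ₂
  · refine exists_norm_upperBlock_le (D := 0) (isContracting_empty hC₁0 hC₁)
      (isContracting_of_jointSpectralRadius_lt_one hlt) (by simp) (by simp) fun w _ hw => ?_
    have hw' : w = [] := by simpa using hw
    simp [hw', upperBlock_nil]
  suffices h : ∃ D, ∀ w, IsFactorOfPower p₁ w → IsFactorOfPower p₂ w →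
      ‖upperBlock A₁ B A₂ w‖ ≤ D by
    obtain ⟨D, hD⟩ := h
    exact exists_norm_upperBlock_le (hdom₁.isContracting hirr₁ hρ₁)
      (hdom₂.isContracting hirr₂ hρ₂) (not_not.2 (isFactorOfPower_nil p₁))
      (not_not.2 (isFactorOfPower_nil p₂)) fun w h₁ h₂ => hD w (not_not.1 h₁) (not_not.1 h₂)
  by_cases hrot : p₁.IsRotated p₂
  · have hpow : IsPowerBounded (complexify (wordProd (blockFamily A₁ B A₂) p₁)) := by
      by_contra hnot
      have hP : IsPowerBounded (complexify (wordProd A₁ p₁)) :=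
        isPowerBounded_complexify fun k => by rw [← wordProd_wordPow]; exact hC₁ _
      have hQ : IsPowerBounded (complexify (wordProd A₂ p₁)) :=
        isPowerBounded_complexify fun k => by rw [← wordProd_wordPow]; exact hC₂ _
      have hblocks : complexify (wordProd (blockFamily A₁ B A₂) p₁) =
          Matrix.fromBlocks (complexify (wordProd A₁ p₁))
            ((upperBlock A₁ B A₂ p₁).map fun r : ℝ => (r : ℂ)) 0
            (complexify (wordProd A₂ p₁)) := by
        rw [wordProd_blockFamily, complexify, Matrix.fromBlocks_map,
          Matrix.map_zero _ Complex.ofReal_zero]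
        rfl
      rw [hblocks] at hnot
      obtain ⟨z, hz, hzP, hzQ, u, v, hu0, hu, hv⟩ := exists_chain_of_not_isPowerBounded hP hQ hnot
      rw [← hblocks] at hu hv
      refine hres ⟨hrot, z, ⟨hzP, fun y hy => ?_⟩, ⟨hzQ, fun y hy => ?_⟩,
        hasNontrivialJordanBlock_conj hS'S (wordProd_eq_conj hSS' hS'S hA p₁)
          ⟨u, v, hu0, hu, hv⟩⟩
      · rw [hz]
        exact hP.norm_le_one_of_mem_spectrum hy
      · rw [hz]
        exact hQ.norm_le_one_of_mem_spectrum hy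
    obtain ⟨C, hC⟩ := hpow.exists_norm_pow_le
    obtain ⟨D, hD⟩ := exists_norm_le_of_isFactorOfPower _ p₁ hC
    obtain ⟨E, hE0, hE⟩ := exists_norm_blocks_le n₁ n₂
    refine ⟨E * D, fun w hw _ => ?_⟩
    have h := hD w hw
    rw [wordProd_blockFamily] at h
    exact (hE _ _ _).2.1.trans (mul_le_mul_of_nonneg_left h hE0.le)
  · obtain ⟨E, hE0, hE⟩ := exists_norm_upperBlock_le_mul_length (θ := 1) one_pos
      (by simpa using hC₁) (by simpa using hC₂) B
    refine ⟨E * (p₁.length * p₂.length : ℕ), fun w hw₁ hw₂ => (hE w).trans ?_⟩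
    rw [one_pow, mul_one]
    gcongr
    by_contra! hlong
    exact hrot (hdom₁.1.isRotated_of_common_factor hdom₂.1 hw₁ hw₂ hlong.le)

/-- In resonance the Jordan block belongs to an eigenvalue of modulus one. -/
theorem AreInJordanResonance.exists_norm_eq_one (hSS' : S * S' = 1) (hS'S : S' * S = 1)
    (hA : ∀ j, A j = S * blockFamily A₁ B A₂ j * S') (hrho : jointSpectralRadius A = 1)
    (hirr₁ : ¬ IsReducibleFamily A₁) (hirr₂ : ¬ IsReducibleFamily A₂)
    (hdom₁ : IsDominantWord A₁ p₁) (hdom₂ : IsDominantWord A₂ p₂)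
    (hres : AreInJordanResonance A A₁ A₂ p₁ p₂) :
    ∃ z : ℂ, ‖z‖ = 1 ∧ HasNontrivialJordanBlock (wordProd A p₁) z := by
  obtain ⟨hρ₁, hρ₂⟩ := jointSpectralRadius_blocks_le_one hSS' hS'S hA hrho
  obtain ⟨hrot, z, hz₁, hz₂, hJ⟩ := hres
  rw [IsLeadingEigenvalue, spectrum_complexify_wordProd_of_isRotated A₂ hrot] at hz₂
  obtain ⟨C₁, hC₁0, hC₁⟩ := exists_norm_wordProd_le hirr₁ hρ₁
  have hP : IsPowerBounded (complexify (wordProd A₁ p₁)) :=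
    isPowerBounded_complexify fun k => by rw [← wordProd_wordPow]; exact hC₁ _
  refine ⟨z, le_antisymm (hP.norm_le_one_of_mem_spectrum hz₁.1) ?_, hJ⟩
  -- At least one of the diagonal families has joint spectral radius one.
  rcases hρ₁.lt_or_eq with h₁ | h₁
  · rcases hρ₂.lt_or_eq with h₂ | h₂
    · exact absurd (jointSpectralRadius_lt_one_of_blocks hSS' hS'S hA h₁ h₂)
        (not_lt.2 hrho.ge)
    · exact hdom₂.one_le_norm hirr₂ h₂ hz₂
  · exact hdom₁.one_le_norm hirr₁ h₁ hz₁

theorem exists_maxNorm_le_mul (hSS' : S * S' = 1) (hS'S : S' * S = 1)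
    (hA : ∀ j, A j = S * blockFamily A₁ B A₂ j * S') (hrho : jointSpectralRadius A = 1)
    (hirr₁ : ¬ IsReducibleFamily A₁) (hirr₂ : ¬ IsReducibleFamily A₂) :
    ∃ C, 0 < C ∧ ∀ k : ℕ, 1 ≤ k → maxNorm A k ≤ C * k := by
  obtain ⟨hρ₁, hρ₂⟩ := jointSpectralRadius_blocks_le_one hSS' hS'S hA hrho
  obtain ⟨C₁, hC₁0, hC₁⟩ := exists_norm_wordProd_le hirr₁ hρ₁
  obtain ⟨C₂, hC₂0, hC₂⟩ := exists_norm_wordProd_le hirr₂ hρ₂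
  obtain ⟨E, hE0, hE⟩ := exists_norm_upperBlock_le_mul_length (θ := 1) one_pos
    (by simpa using hC₁) (by simpa using hC₂) B
  obtain ⟨C, hC0, hC⟩ := exists_norm_wordProd_le_add hSS' hS'S hA
  refine ⟨C * (C₁ + E + C₂), by positivity, fun k hk => ?_⟩
  refine maxNorm_le (by positivity) fun w hw => (hC w).trans ?_
  have hk' : (1 : ℝ) ≤ k := by exact_mod_cast hk
  rw [mul_assoc]
  refine mul_le_mul_of_nonneg_left ?_ hC0.le
  have hEw := hE w
  rw [one_pow, mul_one, hw] at hEw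
  have h₁ := hC₁ w
  have h₂ := hC₂ w
  nlinarith

theorem isMarginallyUnstable_iff_and_hasLinearGrowth (hSS' : S * S' = 1) (hS'S : S' * S = 1)
    (hconj : ∀ j, A j = S * blockFamily A₁ B A₂ j * S') (hA : jointSpectralRadius A = 1)
    (hirr₁ : ¬ IsReducibleFamily A₁) (hirr₂ : ¬ IsReducibleFamily A₂)
    (hdom₁ : IsDominantWord A₁ p₁) (hdom₂ : IsDominantWord A₂ p₂) :
    (IsMarginallyUnstable A ↔ AreInJordanResonance A A₁ A₂ p₁ p₂) ∧
      (AreInJordanResonance A A₁ A₂ p₁ p₂ → HasLinearGrowth A) := by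
  have hgrow : AreInJordanResonance A A₁ A₂ p₁ p₂ →
      ∃ c, 0 < c ∧ ∀ k : ℕ, c * k ≤ ‖wordProd A p₁ ^ k‖ := fun hres => by
    obtain ⟨z, hz, hJ⟩ :=
      hres.exists_norm_eq_one hSS' hS'S hconj hA hirr₁ hirr₂ hdom₁ hdom₂
    exact exists_mul_le_norm_pow hz hJ
  refine ⟨⟨fun hunst => ?_, fun hres => ⟨hA, fun hbdd => ?_⟩⟩, fun hres => ?_⟩
  · by_contra hres
    obtain ⟨C, hC⟩ := exists_norm_wordProd_le_of_not_resonance hSS' hS'S hconj hA hirr₁ hirr₂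
      hdom₁ hdom₂ hres
    exact hunst.2 fun x hx => hx.bounded hC
  · obtain ⟨c, hc0, hc⟩ := hgrow hres
    obtain ⟨C, hC⟩ := exists_norm_pow_le_of_bounded_trajectories hbdd hdom₁.1.1
    obtain ⟨k, hk⟩ := exists_nat_gt (C / c)
    rw [div_lt_iff₀' hc0] at hk
    exact absurd ((hc k).trans (hC k)) (not_le.2 hk)
  · obtain ⟨c, hc0, hc⟩ := hgrow hres
    obtain ⟨c', hc'0, hc'⟩ := exists_mul_le_maxNorm hdom₁.1.1 hc0 hc
    obtain ⟨C, hC0, hC⟩ := exists_maxNorm_le_mul hSS' hS'S hconj hA hirr₁ hirr₂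
    exact ⟨c', C, hc'0, hC0, fun k hk => ⟨hc' k, hC k hk⟩⟩

end Resonance

theorem theorem1 {m d d₁ d₂ : ℕ} (hd₁ : 0 < d₁) (hd₂ : 0 < d₂)
    (A : Fin m → Matrix (Fin d) (Fin d) ℝ)
    (A₁ : Fin m → Matrix (Fin d₁) (Fin d₁) ℝ)
    (A₂ : Fin m → Matrix (Fin d₂) (Fin d₂) ℝ)
    (B : Fin m → Matrix (Fin d₁) (Fin d₂) ℝ)
    (b : Module.Basis (Fin d₁ ⊕ Fin d₂) ℝ (Fin d → ℝ))
    (hblocks : ∀ j, LinearMap.toMatrix b b (Matrix.toLin' (A j)) =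
      Matrix.fromBlocks (A₁ j) (B j) 0 (A₂ j))
    (hirr₁ : ¬ IsReducibleFamily A₁) (hirr₂ : ¬ IsReducibleFamily A₂)
    (hA : jointSpectralRadius A = 1)
    (p₁ p₂ : List (Fin m))
    (hdom₁ : IsDominantWord A₁ p₁) (hdom₂ : IsDominantWord A₂ p₂)
    (hlead₁ : HasUniqueSimpleLeadingEigenvalue (wordProd A₁ p₁))
    (hlead₂ : HasUniqueSimpleLeadingEigenvalue (wordProd A₂ p₂)) :
    (IsMarginallyUnstable A ↔ AreInJordanResonance A A₁ A₂ p₁ p₂) ∧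
      (AreInJordanResonance A A₁ A₂ p₁ p₂ → HasLinearGrowth A) := by
  obtain ⟨S, S', hSS', hS'S, hconj⟩ :=
    exists_conj_of_toMatrix_eq (F := blockFamily A₁ B A₂) b hblocks
  exact isMarginallyUnstable_iff_and_hasLinearGrowth hSS' hS'S hconj hA hirr₁ hirr₂ hdom₁ hdom₂
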